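/- **Theorem (Low-Depth Trees).** There is an absolute constant $C>0$ such that the following holds. Let $T$ be a finite tree with positive edge lengths, let $(X,d)$ be a finite metric space whose points are vertices of $T$ and whose distance $d$ is the path length in $T$, and let $D$ be the hop-diameter of $T$, i.e. the maximum number of edges on a simple path of $T$. Then for every $k\ge 1$ there is a deterministic online algorithm that outputs a fractional solution for the $k$-server problem on $(X,d)$ and has competitive ratio at most $C\,D\log(k+1)$ (which is $O(D\log k)$ for $k\ge 2$). Here, for every starting set $A_0\subseteq X$ with $|A_0|=k$ and requests $r_1,r_2,\dots\in X$, the algorithm outputs at each time $t$ a vector $z^t\in[0,1]^X$ that is a function of $A_0,r_1,\dots,r_t$ only, with $\sum_{x\in X} z^t_x=k$, $z^0=\mathbf 1_{A_0}$, and $z^t_{r_t}=1$ for $t\ge 1$. The cost of a solution up to time $m$ is the sum over $t=1,\dots,m$ of the earthmover distance, with respect to $d$, between its configurations at times $t-1$ and $t$. Competitive ratio at most $c$ means that there is a constant $C'$, independent of the request sequence and of $A_0$, such that for every $A_0$, every $r_1,\dots,r_m\in X$ and all sets $B_0,B_1,\dots,B_m\subseteq X$ with $|B_t|=k$ for all $t$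 and $r_t\in B_t$ for $t\ge1$, the cost of $(z^t)_{0\le t\le m}$ is at most $c$ times the cost of $(\mathbf 1_{B_t})_{0\le t\le m}$ plus $C'$. -/

import Mathlib

open scoped BigOperators

noncomputable section

namespace KServer

/-! ### Tree metrics -/

/-- The length of a walk in a graph whose edges `e` have lengths `ℓ e`. -/
def walkLength {V : Type*} {G : SimpleGraph V} (ℓ : Sym2 V → ℝ) {u v : V} (p : G.Walk u v) : ℝ :=
  (p.edges.map ℓ).sum

/-- The hop-diameter: the maximum number of edges on a simple path of the graph
(on a finite vertex set these numbers are bounded, so the supremum is a maximum). -/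
def hopDiameter {V : Type*} (G : SimpleGraph V) : ℕ :=
  sSup {m : ℕ | ∃ (u v : V) (p : G.Walk u v), p.IsPath ∧ p.length = m}

/-- The metric space `X` is the tree metric induced by the tree `G` with positive edge lengths `ℓ`:
each point `x` sits at the vertex `φ x`, and distances in `X` are the lengths of the
(unique) simple paths of the tree. The tree may have vertices that are not points of `X`. -/
structure IsTreeMetric (X : Type*) [MetricSpace X] {V : Type*} (G : SimpleGraph V)
    (ℓ : Sym2 V → ℝ) (φ : X → V) : Prop where
  isTree : G.IsTree
  length_pos : ∀ e ∈ G.edgeSet, 0 < ℓ e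
  dist_eq : ∀ (x y : X) (p : G.Walk (φ x) (φ y)), p.IsPath → dist x y = walkLength ℓ p

/-! ### Movement cost -/

section Movement

variable {X : Type*} [Fintype X]

/-- `π` moves the mass distribution `z` to the mass distribution `z'`. -/
structure IsTransportPlan (z z' : X → ℝ) (π : X → X → ℝ) : Prop where
  nonneg : ∀ x y, 0 ≤ π x y
  source : ∀ x, ∑ y, π x y = z x
  target : ∀ y, ∑ x, π x y = z' y

/-- The earthmover distance. It is only used for two distributions of the same total mass. -/
def earthmover [MetricSpace X] (z z' : X → ℝ) : ℝ :=
  sInf {c : ℝ | ∃ π : X → X → ℝ, IsTransportPlan z z' π ∧ c = ∑ x, ∑ y, π x y * dist x y}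

end Movement

/-! ### The `k`-server problem -/

/-- An integral configuration: the set of the `k` points that hold a server. -/
abbrev ServerConfig (X : Type*) (k : ℕ) : Type _ := {A : Finset X // A.card = k}

/-- The `0/1` vector of an integral configuration. -/
def ServerConfig.toVec {X : Type*} {k : ℕ} (A : ServerConfig X k) : X → ℝ :=
  Set.indicator (A.1 : Set X) (fun _ => 1)

/-- A fractional configuration of `k` servers. -/
structure IsFractionalConfig {X : Type*} [Fintype X] (k : ℕ) (z : X → ℝ) : Prop where
  nonneg : ∀ x, 0 ≤ z x
  le_one : ∀ x, z x ≤ 1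
  sum_eq : ∑ x, z x = k

/-- The integral solution `A 0, A 1, …` (`A t` is the configuration at time `t`) serves the requests
`σ = [r₁, …, r_T]`, that is, `r_t ∈ A t` for `t = 1, …, T`. It may be chosen with knowledge
of all of `σ`, and from any starting configuration `A 0`. -/
def Serves {X : Type*} {k : ℕ} (A : ℕ → ServerConfig X k) (σ : List X) : Prop :=
  ∀ (t : ℕ) (ht : t < σ.length), σ[t] ∈ (A (t + 1)).1

/-- The total movement of the integral solution `A` over the first `T` requests. -/
def integralCost {X : Type*} [Fintype X] [MetricSpace X] {k : ℕ} (A : ℕ → ServerConfig X k)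
    (T : ℕ) : ℝ :=
  ∑ t ∈ Finset.range T, earthmover (A t).toVec (A (t + 1)).toVec

/-- A deterministic online algorithm that outputs a fractional solution of the `k`-server problem.
`state A₀ [r₁, …, r_t]` is its configuration at time `t` when it starts in `A₀`; being a function
of `A₀` and of the requests up to time `t` only, the algorithm is deterministic and online. -/
structure FractionalAlgorithm (X : Type*) [Fintype X] (k : ℕ) where
  state : ServerConfig X k → List X → X → ℝ
  init : ∀ A₀, state A₀ [] = A₀.toVec
  config : ∀ A₀ σ, IsFractionalConfig k (state A₀ σ)
  serves : ∀ A₀ σ r, state A₀ (σ ++ [r]) r = 1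

/-- The total movement of the algorithm on the request sequence `σ`. -/
def FractionalAlgorithm.cost {X : Type*} [Fintype X] [MetricSpace X] {k : ℕ}
    (alg : FractionalAlgorithm X k) (A₀ : ServerConfig X k) (σ : List X) : ℝ :=
  ∑ t ∈ Finset.range σ.length,
    earthmover (alg.state A₀ (σ.take t)) (alg.state A₀ (σ.take (t + 1)))

/-- The algorithm has competitive ratio at most `c`: on every request sequence its cost is at most
`c` times the cost of any (in particular, an optimal) integral solution, up to an additive
constant that does not depend on the request sequence. -/
def FractionalAlgorithm.IsCompetitive {X : Type*} [Fintype X] [MetricSpace X] {k : ℕ}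
    (alg : FractionalAlgorithm X k) (c : ℝ) : Prop :=
  ∃ B : ℝ, ∀ (A₀ : ServerConfig X k) (σ : List X) (A : ℕ → ServerConfig X k),
    Serves A σ → alg.cost A₀ σ ≤ c * integralCost A σ.length + B

end KServer

end

namespace KServer

open Finset Filter Topology

/-! ### Entropic projections -/

section Entropy

/-! The proof is a discrete mirror descent on allotment vectors, followed by a lazy movement of the
servers. Root the tree and hang a short pendant leaf at every point. An allotment `y (u, j)`
measures, up to shift and scale, how far the `j`-th server below the node `u` is missing; all
allotments are at least `δ = floorVal k = 1/(4k)`. The inequalities of `polytope` say that any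
family of servers below the children of `u` must be covered by servers allotted to `u`, and the root
row fixes the number of servers to `k`.

A request `r` calls for a small allotment at the leaf of `r`. `exists_projection_step` minimizes the
weighted relative entropy to the current vector plus a small linear penalty on this coordinate. By
the three-point identity, the divergence from every feasible vector that serves `r` drops by a gain
`G`. Testing optimality in the direction `depth * z`, lowered by `z` on the rising coordinates,
bounds the movement by the change of a bounded linear potential plus `O(depth) * G`. Finitely many
such steps serve `r` (`exists_serving_point`).

An allotment vector yields capacities: at most `k` at the root, superadditive along the tree, at
least `1` at a served leaf, and Lipschitz in the vector. The actual fractional configuration need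
not match them. `exists_lazy_move` moves mass only along edges where this reduces the weighted gap
between subtree masses and capacities, so the gap pays for the movement.

`statePot` adds the gap, the linear potential and a multiple of the divergence from the offline
configuration. The online cost is paid by its decrease. An offline move changes the divergence by
`O(log k)` per unit of weighted subtree mass, because allotments lie between `1/(4k)` and `2`. This
gives the ratio `O(depth * log k)`, and the depth is at most the hop-diameter plus one. -/

/-- The pointwise relative entropy `a log (a / b) - a + b`. -/
noncomputable def relEnt (a b : ℝ) : ℝ := a * Real.log a - a * Real.log b - a + b

@[simp] lemma relEnt_self (a : ℝ) : relEnt a a = 0 := by simp [relEnt]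

/-- Convexity in the first argument: the increment is at most the increment times the slope at the
end point `a`. -/
lemma relEnt_sub_le {a a' b : ℝ} (ha : 0 < a) (ha' : 0 < a') :
    relEnt a b - relEnt a' b ≤ (a - a') * (Real.log a - Real.log b) := by
  have h := Real.add_one_le_exp (Real.log (a / a'))
  have h1 : Real.log (a' / a) ≤ a' / a - 1 := Real.log_le_sub_one_of_pos (by positivity)
  rw [Real.log_div ha'.ne' ha.ne'] at h1
  have h2 : a * (a' / a - 1) = a' - a := by field_simp
  have h3 : a' * (Real.log a - Real.log a') ≤ a - a' := by
    have h1 : Real.log (a / a') ≤ a / a' - 1 := Real.log_le_sub_one_of_pos (by positivity)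
    rw [Real.log_div ha.ne' ha'.ne'] at h1
    have h4 : a' * (a / a' - 1) = a - a' := by field_simp
    nlinarith [mul_le_mul_of_nonneg_left h1 ha'.le]
  have h5 : a' * (Real.log a' - Real.log a) ≥ a' - a := by linarith
  unfold relEnt
  nlinarith

/-- The Hellinger lower bound. It turns a small divergence into multiplicative closeness of the
coordinates. -/
lemma sq_sqrt_sub_le_relEnt {a b : ℝ} (ha : 0 < a) (hb : 0 < b) :
    (√a - √b) ^ 2 ≤ relEnt a b := by
  have hs := Real.sq_sqrt ha.le
  have ht := Real.sq_sqrt hb.le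
  have hsa := Real.sqrt_pos.2 ha
  have hsb := Real.sqrt_pos.2 hb
  have h1 : Real.log (√b / √a) ≤ √b / √a - 1 := Real.log_le_sub_one_of_pos (by positivity)
  rw [Real.log_div hsb.ne' hsa.ne', Real.log_sqrt hb.le, Real.log_sqrt ha.le] at h1
  have h2 : a * (√b / √a - 1) = √a * √b - a := by
    field_simp; nlinarith
  have h3 := mul_le_mul_of_nonneg_left h1 ha.le
  unfold relEnt
  nlinarith

lemma relEnt_nonneg {a b : ℝ} (ha : 0 < a) (hb : 0 < b) : 0 ≤ relEnt a b :=
  (sq_nonneg _).trans (sq_sqrt_sub_le_relEnt ha hb)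

/-- To the right of `b` the entropy increases in its first argument, so truncation at a height above
`b` cannot increase it. -/
lemma relEnt_min_le {a b U : ℝ} (ha : 0 < a) (hb : 0 < b) (hbU : b ≤ U) :
    relEnt (min a U) b ≤ relEnt a b := by
  rcases le_total a U with h | h
  · rw [min_eq_left h]
  · rw [min_eq_right h]
    have hU : 0 < U := hb.trans_le hbU
    have h1 := relEnt_sub_le (b := b) hU ha
    have h2 : 0 ≤ Real.log U - Real.log b := sub_nonneg.2 (Real.log_le_log hb hbU)
    nlinarith

variable {ι : Type*}

/-- The weighted relative entropy of two vectors over the coordinates in `I`. -/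
noncomputable def entDiv (I : Finset ι) (w : ι → ℝ) (a b : ι → ℝ) : ℝ :=
  ∑ p ∈ I, w p * relEnt (a p) (b p)

lemma entDiv_nonneg {I : Finset ι} {w a b : ι → ℝ} (hw : ∀ p, 0 ≤ w p) (ha : ∀ p, 0 < a p)
    (hb : ∀ p, 0 < b p) : 0 ≤ entDiv I w a b :=
  Finset.sum_nonneg fun p _ => mul_nonneg (hw p) (relEnt_nonneg (ha p) (hb p))

lemma entDiv_self (I : Finset ι) (w a : ι → ℝ) : entDiv I w a a = 0 := by simp [entDiv]

/-- The Bregman identity; combined with first-order optimality of `b` it measures the progress of a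
projection towards `a`. -/
lemma entDiv_three_point (I : Finset ι) (w a b c : ι → ℝ) :
    entDiv I w a c - entDiv I w a b =
      entDiv I w b c + ∑ p ∈ I, w p * ((a p - b p) * (Real.log (b p) - Real.log (c p))) := by
  unfold entDiv
  rw [← Finset.sum_sub_distrib, ← Finset.sum_add_distrib]
  refine Finset.sum_congr rfl fun p _ => ?_
  unfold relEnt
  ring

/-- Entropic projection with a linear penalty on the coordinate `r`, over a closed convex set
of vectors that is stable under truncation at height `U`: the minimizer satisfies
the first-order optimality condition against every point of the set. -/
theorem exists_entropic_projection (I : Finset ι) (w : ι → ℝ) (hw : ∀ p, 0 ≤ w p)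
    (P : Set (ι → ℝ)) (hcl : IsClosed P) (hconv : Convex ℝ P) {δ U γ : ℝ} (hδ : 0 < δ)
    (hγ : 0 ≤ γ) (hlow : ∀ y ∈ P, ∀ p, δ ≤ y p)
    (htrunc : ∀ y ∈ P, (fun p => min (y p) U) ∈ P)
    (r : ι) (z : ι → ℝ) (hz : z ∈ P) (hzU : ∀ p, z p ≤ U) :
    ∃ y ∈ P, (∀ p, y p ≤ U) ∧ entDiv I w y z + γ * y r ≤ γ * z r ∧
      ∀ x ∈ P, 0 ≤ (∑ p ∈ I, w p * ((x p - y p) * (Real.log (y p) - Real.log (z p))))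
        + γ * (x r - y r) := by
  have hpos : ∀ y ∈ P, ∀ p, 0 < y p := fun y hy p => hδ.trans_le (hlow y hy p)
  -- `P` is unbounded, so the minimum is taken over its compact part below height `U`.
  set K : Set (ι → ℝ) := P ∩ Set.pi Set.univ (fun _ => Set.Icc δ U) with hK
  have hKc : IsCompact K := (isCompact_univ_pi fun _ => isCompact_Icc).inter_left hcl
  have hzK : z ∈ K := ⟨hz, fun p _ => ⟨hlow z hz p, hzU p⟩⟩
  set f : (ι → ℝ) → ℝ := fun y => entDiv I w y z + γ * y r with hf
  have hfc : Continuous f := by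
    refine Continuous.add ?_ (by fun_prop)
    refine continuous_finsetSum _ fun p _ => ?_
    refine continuous_const.mul ?_
    unfold relEnt
    have : Continuous fun y : ι → ℝ => y p * Real.log (y p) :=
      Real.continuous_mul_log.comp (continuous_apply p)
    fun_prop
  obtain ⟨y, hyK, hmin⟩ := hKc.exists_isMinOn ⟨z, hzK⟩ hfc.continuousOn
  refine ⟨y, hyK.1, fun p => (hyK.2 p trivial).2, ?_, ?_⟩
  · have := hmin hzK
    simpa [hf, entDiv_self] using this
  intro x hx
  -- Truncation does not increase the objective, so `y` is minimal over all of `P`. Later test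
  -- points may therefore exceed the height `U`.
  have hminP : ∀ x ∈ P, f y ≤ f x := by
    intro x hx
    have h1 : (fun p => min (x p) U) ∈ K :=
      ⟨htrunc x hx, fun p _ => ⟨hlow _ (htrunc x hx) p, min_le_right _ _⟩⟩
    refine (hmin h1).trans ?_
    refine add_le_add (Finset.sum_le_sum fun p _ => mul_le_mul_of_nonneg_left ?_ (hw p))
      (mul_le_mul_of_nonneg_left (min_le_left _ _) hγ)
    exact relEnt_min_le (hpos x hx p) (hpos z hz p) (hzU p)
  -- Minimality along the segment from `y` to `x`, divided by `t`; the limit `t → 0` gives the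
  -- optimality condition.
  have key : ∀ t : ℝ, 0 < t → t ≤ 1 →
      0 ≤ (∑ p ∈ I, w p * ((x p - y p) *
        (Real.log (y p + t * (x p - y p)) - Real.log (z p)))) + γ * (x r - y r) := by
    intro t ht ht1
    have hyt : (fun p => y p + t * (x p - y p)) ∈ P := by
      have := hconv hyK.1 hx (sub_nonneg.2 ht1) ht.le (by ring)
      convert this using 1
      ext p
      simp only [Pi.add_apply, Pi.smul_apply, smul_eq_mul]
      ring
    have h1 := hminP _ hyt
    have h2 : f (fun p => y p + t * (x p - y p)) - f y ≤
        t * ((∑ p ∈ I, w p * ((x p - y p) *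
        (Real.log (y p + t * (x p - y p)) - Real.log (z p)))) + γ * (x r - y r)) := by
      have h3 : entDiv I w (fun p => y p + t * (x p - y p)) z - entDiv I w y z ≤
          t * (∑ p ∈ I, w p * ((x p - y p) *
          (Real.log (y p + t * (x p - y p)) - Real.log (z p)))) := by
        unfold entDiv
        rw [← Finset.sum_sub_distrib, Finset.mul_sum]
        refine Finset.sum_le_sum fun p _ => ?_
        have h4 := relEnt_sub_le (b := z p) (hpos _ hyt p) (hpos y hyK.1 p)
        have h5 := mul_le_mul_of_nonneg_left h4 (hw p)
        nlinarith
      simp only [hf]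
      nlinarith
    exact nonneg_of_mul_nonneg_right (by linarith : 0 ≤ t * _) ht
  have hlim : Tendsto (fun t : ℝ => (∑ p ∈ I, w p * ((x p - y p) *
        (Real.log (y p + t * (x p - y p)) - Real.log (z p)))) + γ * (x r - y r)) (𝓝[>] 0)
      (𝓝 ((∑ p ∈ I, w p * ((x p - y p) *
        (Real.log (y p) - Real.log (z p)))) + γ * (x r - y r))) := by
    refine Tendsto.mono_left ?_ nhdsWithin_le_nhds
    refine Tendsto.add ?_ tendsto_const_nhds
    refine tendsto_finsetSum _ fun p _ => ?_
    refine tendsto_const_nhds.mul (tendsto_const_nhds.mul (Tendsto.sub ?_ tendsto_const_nhds))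
    refine Tendsto.log ?_ (hpos y hyK.1 p).ne'
    have : Continuous fun t : ℝ => y p + t * (x p - y p) := by fun_prop
    simpa using this.tendsto 0
  refine ge_of_tendsto hlim ?_
  filter_upwards [Ioc_mem_nhdsGT (zero_lt_one' ℝ)] with t ht
  exact key t ht.1 ht.2

end Entropy

/-! ### Rooted hierarchies -/

/-- A rooted tree on the nodes `N` in which every point of `X` is a childless node;
`cluster u` is the set of the points below `u`, and `w u` is the length of the edge above `u`. -/
structure Hierarchy (X N : Type*) [Fintype X] [Fintype N] [DecidableEq N] where
  root : N
  par : N → N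
  depth : N → ℕ
  pt : X → N
  cluster : N → Finset X
  w : N → ℝ
  w_pos : ∀ u, 0 < w u
  depth_root : depth root = 0
  depth_par : ∀ u, u ≠ root → depth u = depth (par u) + 1
  cluster_root : cluster root = Finset.univ
  cluster_pt : ∀ x, cluster (pt x) = {x}
  pt_ne_root : ∀ x, pt x ≠ root
  par_ne_pt : ∀ u, u ≠ root → ∀ x, par u ≠ pt x
  sum_children : ∀ u, (∀ x, u ≠ pt x) → ∀ f : X → ℝ,
    ∑ x ∈ cluster u, f x =
      ∑ v ∈ Finset.univ.filter (fun v => v ≠ root ∧ par v = u), ∑ x ∈ cluster v, f x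
  cluster_subset : ∀ (a : X) (u v : N), a ∈ cluster u → a ∈ cluster v → depth u ≤ depth v →
    cluster v ⊆ cluster u
  eq_of_mem_cluster : ∀ (a : X) (u v : N), a ∈ cluster u → a ∈ cluster v →
    depth u = depth v → u = v

/-! ### The allotment polytope -/

/-- The distance from below at which the allotments are kept. -/
noncomputable def floorVal (k : ℕ) : ℝ := 1 / (4 * k)

lemma floorVal_pos {k : ℕ} (hk : 1 ≤ k) : 0 < floorVal k := by
  have : (0 : ℝ) < k := by exact_mod_cast hk
  unfold floorVal; positivity

lemma mul_floorVal {k : ℕ} (hk : 1 ≤ k) : (k : ℝ) * floorVal k = 1 / 4 := by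
  have : (0 : ℝ) < k := by exact_mod_cast hk
  unfold floorVal; field_simp

lemma floorVal_le {k : ℕ} (hk : 1 ≤ k) : floorVal k ≤ 1 / 4 := by
  have h1 : (1 : ℝ) ≤ k := by exact_mod_cast hk
  have := mul_floorVal hk
  have := floorVal_pos hk
  nlinarith

/-- The allotment vector prescribed at the root. -/
noncomputable def rootRow (k j : ℕ) : ℝ :=
  floorVal k + if j < k then 0 else if j = k then 5 / 4 else 1

lemma floorVal_le_rootRow (k j : ℕ) : floorVal k ≤ rootRow k j := by
  unfold rootRow; split_ifs <;> norm_num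

lemma rootRow_le_two {k : ℕ} (hk : 1 ≤ k) (j : ℕ) : rootRow k j ≤ 2 := by
  have := floorVal_le hk
  unfold rootRow; split_ifs <;> linarith

lemma sum_rootRow_of_le {k m : ℕ} (h : m ≤ k) :
    ∑ j ∈ range m, rootRow k j = m * floorVal k := by
  rw [Finset.sum_congr rfl (g := fun _ => floorVal k)]
  · simp
  · intro j hj
    have : j < k := (Finset.mem_range.1 hj).trans_le h
    simp [rootRow, this]

/-- The extra `1/4` in the entry `j = k` equals `k * floorVal k`. It makes the root capacity come
out as at most `k`. -/
lemma sum_rootRow_of_lt {k m : ℕ} (h : k < m) :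
    ∑ j ∈ range m, rootRow k j = m * floorVal k + 1 / 4 + (m - k) := by
  induction m, h using Nat.le_induction with
  | base =>
    rw [Finset.sum_range_succ, sum_rootRow_of_le le_rfl]
    simp [rootRow]; ring
  | succ m hm ih =>
    have h1 : ¬ m < k := by omega
    have h2 : m ≠ k := by omega
    rw [Finset.sum_range_succ, ih]
    simp [rootRow, h1, h2]; ring

namespace Hierarchy

variable {X N : Type*} [Fintype X] [Fintype N] [DecidableEq N] (T : Hierarchy X N)

/-- The nodes directly below `u`. -/
def children (u : N) : Finset N := Finset.univ.filter (fun v => v ≠ T.root ∧ T.par v = u)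

/-- `p` is one of the allotments of a child of `u`. -/
def IsSlot (u : N) (p : N × ℕ) : Prop :=
  p.1 ≠ T.root ∧ T.par p.1 = u ∧ p.2 < (T.cluster p.1).card

/-- The allotments over which divergences and movements are measured. -/
def slots : Finset (N × ℕ) := Finset.univ ×ˢ range (Fintype.card X)

/-- The weight of an allotment is the length of the edge above its node. -/
def slotWeight (p : N × ℕ) : ℝ := T.w p.1

/-- The allotment polytope. -/
def polytope (k : ℕ) : Set (N × ℕ → ℝ) :=
  {y | (∀ p, floorVal k ≤ y p) ∧ (∀ j, y (T.root, j) = rootRow k j) ∧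
    ∀ (u : N) (A : Finset (N × ℕ)), (∀ p ∈ A, T.IsSlot u p) →
      ∑ j ∈ range A.card, y (u, j) ≤ ∑ p ∈ A, y p}

lemma isClosed_polytope (k : ℕ) : IsClosed (T.polytope k) := by
  simp only [polytope, Set.ofPred_and, Set.ofPred_forall]
  refine IsClosed.inter (isClosed_iInter fun p => ?_)
    (IsClosed.inter (isClosed_iInter fun j => ?_)
      (isClosed_iInter fun u => isClosed_iInter fun A => isClosed_iInter fun _ => ?_))
  · exact isClosed_le continuous_const (continuous_apply p)
  · exact isClosed_eq (continuous_apply _) continuous_const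
  · exact isClosed_le (continuous_finsetSum _ fun _ _ => continuous_apply _)
      (continuous_finsetSum _ fun _ _ => continuous_apply _)

lemma convex_polytope (k : ℕ) : Convex ℝ (T.polytope k) := by
  rintro x ⟨hx1, hx2, hx3⟩ y ⟨hy1, hy2, hy3⟩ a b ha hb hab
  refine ⟨fun p => ?_, fun j => ?_, fun u A hA => ?_⟩
  · simp only [Pi.add_apply, Pi.smul_apply, smul_eq_mul]
    calc floorVal k = a * floorVal k + b * floorVal k := by rw [← add_mul, hab, one_mul]
      _ ≤ _ := add_le_add (mul_le_mul_of_nonneg_left (hx1 p) ha)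
        (mul_le_mul_of_nonneg_left (hy1 p) hb)
  · simp only [Pi.add_apply, Pi.smul_apply, smul_eq_mul, hx2, hy2]
    rw [← add_mul, hab, one_mul]
  · simp only [Pi.add_apply, Pi.smul_apply, smul_eq_mul, Finset.sum_add_distrib, ← Finset.mul_sum]
    exact add_le_add (mul_le_mul_of_nonneg_left (hx3 u A hA) ha)
      (mul_le_mul_of_nonneg_left (hy3 u A hA) hb)

lemma min_mem_polytope {k : ℕ} (hk : 1 ≤ k) {y : N × ℕ → ℝ} (hy : y ∈ T.polytope k) :
    (fun p => min (y p) 2) ∈ T.polytope k := by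
  obtain ⟨h1, h2, h3⟩ := hy
  refine ⟨fun p => le_min (h1 p) ?_, fun j => ?_, fun u A hA => ?_⟩
  · linarith [floorVal_le hk]
  · simp only [h2]
    exact min_eq_left (rootRow_le_two hk j)
  · classical
    -- Only the slots in `B` survive the truncation unchanged. The constraint is applied to `B`, and
    -- each remaining slot contributes `2` on the right against at most `2` on the left.
    set B := A.filter (fun p => y p < 2) with hB
    have hsum : ∑ p ∈ A, min (y p) 2 = ∑ p ∈ B, y p + ((A.card : ℝ) - B.card) * 2 := by
      rw [← Finset.sum_filter_add_sum_filter_not A (fun p => y p < 2)]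
      congr 1
      · refine Finset.sum_congr rfl fun p hp => ?_
        exact min_eq_left (Finset.mem_filter.1 hp).2.le
      · rw [Finset.sum_congr rfl (g := fun _ => (2 : ℝ))]
        · have := Finset.card_filter_add_card_filter_not (s := A) (fun p => y p < 2)
          rw [Finset.sum_const, nsmul_eq_mul, ← this, ← hB]
          push_cast; ring
        · intro p hp
          exact min_eq_right (not_lt.1 (Finset.mem_filter.1 hp).2)
    have hle : B.card ≤ A.card := Finset.card_filter_le _ _
    rw [hsum]
    have h4 : ∑ j ∈ range A.card, min (y (u, j)) 2 ≤
        ∑ j ∈ range B.card, y (u, j) + ((A.card : ℝ) - B.card) * 2 := by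
      rw [← Finset.sum_range_add_sum_Ico _ hle]
      refine add_le_add (Finset.sum_le_sum fun _ _ => min_le_left _ _) ?_
      refine (Finset.sum_le_sum fun _ _ => min_le_right _ _).trans ?_
      rw [Finset.sum_const, nsmul_eq_mul, Nat.card_Ico, Nat.cast_sub hle]
    have h5 := h3 u B (fun p hp => hA p (Finset.mem_filter.1 hp).1)
    linarith

/-- Depth-weighted multiples of a feasible vector are directions of recession. -/
lemma add_mem_polytope {k : ℕ} (hk : 1 ≤ k) {y z s : N × ℕ → ℝ} (hy : y ∈ T.polytope k)
    (hz : z ∈ T.polytope k) (hs0 : ∀ p, 0 ≤ s p) (hs1 : ∀ p, s p ≤ 1)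
    (hsr : ∀ j, s (T.root, j) = 0) :
    (fun p => y p + ((T.depth p.1 : ℝ) - s p) * z p) ∈ T.polytope k := by
  obtain ⟨h1, h2, h3⟩ := hy
  obtain ⟨g1, g2, g3⟩ := hz
  have hδ := floorVal_pos hk
  have hzp : ∀ p, 0 ≤ z p := fun p => hδ.le.trans (g1 p)
  have hd : ∀ p : N × ℕ, p.1 ≠ T.root → (1 : ℝ) ≤ T.depth p.1 := by
    intro p hp
    have := T.depth_par p.1 hp
    exact_mod_cast (by omega : 1 ≤ T.depth p.1)
  refine ⟨fun p => ?_, fun j => ?_, fun u A hA => ?_⟩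
  · have : 0 ≤ ((T.depth p.1 : ℝ) - s p) * z p := by
      refine mul_nonneg ?_ (hzp p)
      by_cases hp : p.1 = T.root
      · obtain ⟨u, j⟩ := p
        simp only at hp
        subst hp
        simp [hsr, T.depth_root]
      · linarith [hd p hp, hs1 p]
    linarith [h1 p]
  · simp [h2, hsr, T.depth_root]
  · rw [Finset.sum_add_distrib, Finset.sum_add_distrib]
    refine add_le_add (h3 u A hA) ?_
    -- The depth grows by one from `u` to its children, so the child coefficients, at least `depth u
    -- + 1 - 1`, still dominate those of `u`.
    calc ∑ j ∈ range A.card, ((T.depth u : ℝ) - s (u, j)) * z (u, j)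
        ≤ ∑ j ∈ range A.card, (T.depth u : ℝ) * z (u, j) :=
          Finset.sum_le_sum fun j _ =>
            mul_le_mul_of_nonneg_right (by linarith [hs0 (u, j)]) (hzp _)
      _ = (T.depth u : ℝ) * ∑ j ∈ range A.card, z (u, j) := by rw [Finset.mul_sum]
      _ ≤ (T.depth u : ℝ) * ∑ p ∈ A, z p :=
          mul_le_mul_of_nonneg_left (g3 u A hA) (Nat.cast_nonneg _)
      _ = ∑ p ∈ A, (T.depth u : ℝ) * z p := by rw [Finset.mul_sum]
      _ ≤ _ := Finset.sum_le_sum fun p hp => by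
          have h4 := hA p hp
          have h5 : T.depth p.1 = T.depth u + 1 := by rw [T.depth_par p.1 h4.1, h4.2.1]
          rw [h5]
          push_cast
          exact mul_le_mul_of_nonneg_right (by linarith [hs1 p]) (hzp _)

/-! ### The projection step -/

/-- The linear potential that pays for the difference between upward and downward movement. -/
noncomputable def linPot (y : N × ℕ → ℝ) : ℝ :=
  ∑ p ∈ slots (X := X) (N := N), T.slotWeight p * ((4 * (T.depth p.1 : ℝ) - 1) * y p)

/-- The movement of allotments, weighted by edge lengths. -/
noncomputable def movement (y z : N × ℕ → ℝ) : ℝ :=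
  ∑ p ∈ slots (X := X) (N := N), T.slotWeight p * |y p - z p|

/-- The divergence on allotment vectors. -/
noncomputable def div (y z : N × ℕ → ℝ) : ℝ :=
  entDiv (slots (X := X) (N := N)) T.slotWeight y z

lemma exists_pos_le_w : ∃ c : ℝ, 0 < c ∧ ∀ u, c ≤ T.w u := by
  obtain ⟨u, -, hu⟩ := Finset.exists_min_image Finset.univ T.w ⟨T.root, Finset.mem_univ _⟩
  exact ⟨T.w u, T.w_pos u, fun v => hu v (Finset.mem_univ v)⟩

lemma mem_slots_pt (r : X) : (T.pt r, 0) ∈ slots (X := X) (N := N) := by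
  simp [slots, Fintype.card_pos_iff]
  exact ⟨r⟩

/-- One projection step towards a point `r` that is not yet served. -/
theorem exists_projection_step {k : ℕ} (hk : 1 ≤ k) {m : ℕ} (hm : ∀ u, T.depth u ≤ m) :
    ∃ c : ℝ, 0 < c ∧ ∀ z ∈ T.polytope k, (∀ p, z p ≤ 2) → ∀ r : X,
      2 * floorVal k < z (T.pt r, 0) →
      ∃ y ∈ T.polytope k, (∀ p, y p ≤ 2) ∧ ∃ G : ℝ, c ≤ G ∧
        (∀ x ∈ T.polytope k, x (T.pt r, 0) = floorVal k → T.div x y + G ≤ T.div x z) ∧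
        T.movement z y ≤ T.linPot y - T.linPot z + 16 * m * G := by
  obtain ⟨c, hc, hcw⟩ := T.exists_pos_le_w
  have hδ := floorVal_pos hk
  have hw : ∀ p : N × ℕ, 0 < T.slotWeight p := fun p => T.w_pos p.1
  set δ := floorVal k with hδdef
  -- So small that a step has divergence at most `2 * γ = δ * c / 100`; every square root then
  -- changes by at most a tenth of itself.
  set γ := δ * c / 200 with hγ
  have hγ0 : 0 < γ := by positivity
  refine ⟨γ * (δ / 2), by positivity, ?_⟩
  intro z hz hz2 r hr
  obtain ⟨y, hy, hy2, hle, hvi⟩ := exists_entropic_projection (slots (X := X) (N := N))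
    T.slotWeight (fun p => (hw p).le) (T.polytope k) (T.isClosed_polytope k) (T.convex_polytope k)
    hδ hγ0.le (fun y hy => hy.1) (fun y hy => T.min_mem_polytope hk hy) (T.pt r, 0) z hz hz2
  set q : N × ℕ := (T.pt r, 0) with hq
  have hyp : ∀ p, 0 < y p := fun p => hδ.trans_le (hy.1 p)
  have hzp : ∀ p, 0 < z p := fun p => hδ.trans_le (hz.1 p)
  have hratio : ∀ p ∈ slots (X := X) (N := N), 3 / 4 * z p ≤ y p ∧ y p ≤ 2 * z p := by
    intro p hp
    have h1 : T.slotWeight p * relEnt (y p) (z p) ≤ γ * 2 := by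
      have h2 : T.slotWeight p * relEnt (y p) (z p) ≤
          entDiv (slots (X := X) (N := N)) T.slotWeight y z :=
        Finset.single_le_sum (f := fun p => T.slotWeight p * relEnt (y p) (z p))
          (fun p _ => mul_nonneg (hw p).le (relEnt_nonneg (hyp p) (hzp p))) hp
      have h3 : γ * z q ≤ γ * 2 := mul_le_mul_of_nonneg_left (hz2 q) hγ0.le
      have h4 : 0 ≤ γ * y q := mul_nonneg hγ0.le (hyp q).le
      linarith
    have h2 := sq_sqrt_sub_le_relEnt (hyp p) (hzp p)
    have h3 : c * (√(y p) - √(z p)) ^ 2 ≤ γ * 2 := by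
      refine le_trans ?_ h1
      exact mul_le_mul (hcw p.1) h2 (sq_nonneg _) (hw p).le
    have h4 : (√(y p) - √(z p)) ^ 2 ≤ z p / 100 := by
      have h5 : c * (√(y p) - √(z p)) ^ 2 ≤ c * (δ / 100) := by
        rw [hγ] at h3; linarith
      have h6 := le_of_mul_le_mul_left h5 hc
      linarith [hz.1 p]
    have hsy := Real.sq_sqrt (hyp p).le
    have hsz := Real.sq_sqrt (hzp p).le
    have hpy := Real.sqrt_pos.2 (hyp p)
    have hpz := Real.sqrt_pos.2 (hzp p)
    have h5 : |√(y p) - √(z p)| ≤ √(z p) / 10 := by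
      refine abs_le_of_sq_le_sq ?_ (by positivity)
      rw [div_pow, hsz]; linarith
    rw [abs_le] at h5
    constructor
    · nlinarith
    · nlinarith
  have hqs := T.mem_slots_pt r
  have hyq := (hratio q hqs).1
  set G := γ * (y q - δ) with hG
  -- From `2 * δ < z q` and `3/4 * z q ≤ y q`: the gain is comparable with the full penalty.
  have hGz : γ * z q ≤ 4 * G := by
    have : z q ≤ 4 * (y q - δ) := by linarith
    rw [hG]; nlinarith
  refine ⟨y, hy, hy2, G, ?_, ?_, ?_⟩
  · rw [hG]
    refine mul_le_mul_of_nonneg_left ?_ hγ0.le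
    linarith
  · intro x hx hxq
    have h1 := hvi x hx
    have h2 := entDiv_three_point (slots (X := X) (N := N)) T.slotWeight x y z
    have h3 := entDiv_nonneg (I := slots (X := X) (N := N)) (w := T.slotWeight) (a := y) (b := z)
      (fun p => (hw p).le) hyp hzp
    unfold div
    rw [hxq] at h1
    rw [hG]
    linarith
  · classical
    -- Subtracting `z` only on rising coordinates makes the test direction detect upward movement.
    set s : N × ℕ → ℝ := fun p => if p.1 ≠ T.root ∧ z p < y p then 1 else 0 with hs
    have hs0 : ∀ p, 0 ≤ s p := fun p => by simp only [hs]; split_ifs <;> norm_num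
    have hs1 : ∀ p, s p ≤ 1 := fun p => by simp only [hs]; split_ifs <;> norm_num
    have h1 := hvi _ (T.add_mem_polytope hk hy hz hs0 hs1 (fun j => by simp [hs]))
    -- The depth part uses `z log (y/z) ≤ y - z`. On rising coordinates `z log (y/z) ≥ (z/y) (y - z)
    -- ≥ (y - z)/2`, since `y ≤ 2 z`.
    have h2 : ∀ p ∈ slots (X := X) (N := N), T.slotWeight p *
        ((y p + ((T.depth p.1 : ℝ) - s p) * z p - y p) * (Real.log (y p) - Real.log (z p)))
        ≤ T.slotWeight p * ((T.depth p.1 : ℝ) * (y p - z p)) -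
          T.slotWeight p * (max (y p - z p) 0 / 2) := by
      intro p hp
      rw [← mul_sub]
      refine mul_le_mul_of_nonneg_left ?_ (hw p).le
      have hlog : z p * (Real.log (y p) - Real.log (z p)) ≤ y p - z p := by
        have h1 : Real.log (y p / z p) ≤ y p / z p - 1 :=
          Real.log_le_sub_one_of_pos (div_pos (hyp p) (hzp p))
        rw [Real.log_div (hyp p).ne' (hzp p).ne'] at h1
        have h4 : z p * (y p / z p - 1) = y p - z p := by
          have := (hzp p).ne'
          field_simp
        nlinarith [mul_le_mul_of_nonneg_left h1 (hzp p).le]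
      have h3 : (T.depth p.1 : ℝ) * (z p * (Real.log (y p) - Real.log (z p))) ≤
          T.depth p.1 * (y p - z p) := mul_le_mul_of_nonneg_left hlog (Nat.cast_nonneg _)
      have h4 : max (y p - z p) 0 / 2 ≤ s p * (z p * (Real.log (y p) - Real.log (z p))) := by
        by_cases hpr : p.1 = T.root
        · obtain ⟨u, j⟩ := p
          simp only at hpr
          subst hpr
          rw [hy.2.1 j, hz.2.1 j]
          simp
        · by_cases hlt : z p < y p
          · have hsp : s p = 1 := by simp [hs, hpr, hlt]
            rw [hsp, one_mul, max_eq_left (by linarith)]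
            have h5 : Real.log (z p / y p) ≤ z p / y p - 1 :=
              Real.log_le_sub_one_of_pos (div_pos (hzp p) (hyp p))
            rw [Real.log_div (hzp p).ne' (hyp p).ne'] at h5
            have h6 : (y p - z p) / 2 ≤ z p * (1 - z p / y p) := by
              have h7 := (hratio p hp).2
              have h8 : z p * (1 - z p / y p) = (z p / y p) * (y p - z p) := by
                have := (hyp p).ne'
                field_simp
              have h9 : 1 / 2 ≤ z p / y p := by
                rw [div_le_div_iff₀ two_pos (hyp p)]; linarith
              rw [h8]
              nlinarith
            refine h6.trans (mul_le_mul_of_nonneg_left (by linarith) (hzp p).le)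
          · have hsp : s p = 0 := by simp [hs, hlt]
            rw [hsp, zero_mul, max_eq_right (by linarith)]
            simp
      nlinarith
    have h3 := Finset.sum_le_sum h2
    have h4 : γ * (y q + ((T.depth q.1 : ℝ) - s q) * z q - y q) ≤ m * (4 * G) := by
      have h5 : γ * (y q + ((T.depth q.1 : ℝ) - s q) * z q - y q) ≤
          (T.depth q.1 : ℝ) * (γ * z q) := by
        have := mul_nonneg (hs0 q) (mul_nonneg hγ0.le (hzp q).le)
        nlinarith
      have h6 : (T.depth q.1 : ℝ) ≤ m := by exact_mod_cast hm q.1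
      refine h5.trans (mul_le_mul h6 hGz (mul_nonneg hγ0.le (hzp q).le) (Nat.cast_nonneg _))
    rw [Finset.sum_sub_distrib] at h3
    -- Total movement is twice the upward movement minus the net change. This explains the
    -- coefficient `4 * depth - 1` in `linPot`.
    have h5 : T.movement z y = 4 * (∑ p ∈ slots (X := X) (N := N),
        T.slotWeight p * (max (y p - z p) 0 / 2)) -
        ∑ p ∈ slots (X := X) (N := N), T.slotWeight p * (y p - z p) := by
      unfold movement
      rw [Finset.mul_sum, ← Finset.sum_sub_distrib]
      refine Finset.sum_congr rfl fun p _ => ?_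
      rcases le_total (y p) (z p) with h | h
      · rw [max_eq_right (by linarith), abs_of_nonneg (by linarith)]; ring
      · rw [max_eq_left (by linarith), abs_of_nonpos (by linarith)]; ring
    have h6 : T.linPot y - T.linPot z = 4 * (∑ p ∈ slots (X := X) (N := N),
        T.slotWeight p * ((T.depth p.1 : ℝ) * (y p - z p))) -
        ∑ p ∈ slots (X := X) (N := N), T.slotWeight p * (y p - z p) := by
      unfold linPot
      rw [Finset.mul_sum, ← Finset.sum_sub_distrib, ← Finset.sum_sub_distrib]
      refine Finset.sum_congr rfl fun p _ => ?_
      ring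
    rw [h5, h6]
    linarith

end Hierarchy

/-! ### Integral configurations as allotment vectors -/

lemma sum_range_ite_lt (m a : ℕ) (c : ℝ) :
    ∑ j ∈ range m, (if j < a then 0 else c) = c * (m - min m a : ℕ) := by
  induction m with
  | zero => simp
  | succ m ih =>
    rw [Finset.sum_range_succ, ih]
    split_ifs with h
    · rw [show m + 1 - min (m + 1) a = m - min m a by omega, add_zero]
    · rw [show m + 1 - min (m + 1) a = m - min m a + 1 by omega]
      push_cast; ring

lemma sum_range_ite_iff_le (m a b : ℕ) :
    ∑ j ∈ range m, (if (j < a ↔ j < b) then (0 : ℝ) else 1) ≤ |(a : ℝ) - b| := by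
  have h1 : ∑ j ∈ range m, (if (j < a ↔ j < b) then (0 : ℝ) else 1) ≤
      ((Finset.Ico (min a b) (max a b)).card : ℝ) := by
    rw [Finset.card_eq_sum_ones, Nat.cast_sum]
    rw [← Finset.sum_filter_add_sum_filter_not (range m) (fun j => (j < a ↔ j < b))]
    rw [Finset.sum_eq_zero (s := (range m).filter _) (fun j hj => by
      simp [(Finset.mem_filter.1 hj).2]), zero_add]
    refine (Finset.sum_le_sum (g := fun _ => ((1 : ℕ) : ℝ)) fun j _ => ?_).trans
      (Finset.sum_le_sum_of_subset_of_nonneg ?_ fun _ _ _ => by simp)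
    · split_ifs <;> simp
    · intro j hj
      have := (Finset.mem_filter.1 hj).2
      rw [Finset.mem_Ico]
      omega
  refine h1.trans ?_
  rw [Nat.card_Ico, Nat.cast_sub (min_le_max), ← max_sub_min_eq_abs]
  push_cast
  rw [max_comm, min_comm]

/-- Changing the reference value of one allotment changes its divergence by `O(log k)`. -/
lemma abs_relEnt_sub_relEnt_le {k : ℕ} (hk : 1 ≤ k) {y : ℝ} (hy : floorVal k ≤ y) (hy2 : y ≤ 2) :
    |relEnt (floorVal k + 5 / 4) y - relEnt (floorVal k) y| ≤ 10 * Real.log (k + 1) := by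
  have hδ := floorVal_pos hk
  have hδ4 := floorVal_le hk
  have hk1 : (1 : ℝ) ≤ k := by exact_mod_cast hk
  set δ := floorVal k with hd
  have hlog2 : Real.log 2 ≤ Real.log (k + 1) := Real.log_le_log two_pos (by linarith)
  have hl2 := Real.log_two_gt_d9
  have hlogδ : -Real.log δ ≤ 3 * Real.log (k + 1) := by
    have h1 : Real.log δ = -(Real.log 4 + Real.log k) := by
      rw [hd, floorVal, one_div, Real.log_inv, Real.log_mul (by norm_num) (by positivity)]
    have h2 : Real.log 4 = 2 * Real.log 2 := by
      rw [show (4 : ℝ) = 2 ^ 2 by norm_num, Real.log_pow]; norm_num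
    have h3 : Real.log k ≤ Real.log (k + 1) := Real.log_le_log (by positivity) (by linarith)
    linarith
  have hlogδ0 : Real.log δ ≤ 0 := Real.log_nonpos hδ.le (by linarith)
  have hy0 : 0 < y := hδ.trans_le hy
  have hylow : Real.log δ ≤ Real.log y := Real.log_le_log hδ hy
  have hyup : Real.log y ≤ Real.log 2 := Real.log_le_log hy0 hy2
  have h1 : Real.log (δ + 5 / 4) ≤ 1 / 2 := by
    have := Real.log_le_sub_one_of_pos (show 0 < δ + 5 / 4 by linarith)
    linarith
  have h2 : 0 ≤ Real.log (δ + 5 / 4) := Real.log_nonneg (by linarith)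
  have h3 : (δ + 5 / 4) * Real.log (δ + 5 / 4) ≤ 3 / 4 := by nlinarith
  have h4 : 0 ≤ (δ + 5 / 4) * Real.log (δ + 5 / 4) := by positivity
  have h5 : -(δ * Real.log δ) ≤ 1 / 4 * (3 * Real.log (k + 1)) := by nlinarith
  have h6 : 0 ≤ -(δ * Real.log δ) := by nlinarith
  unfold relEnt
  rw [abs_le]
  constructor <;> nlinarith

namespace Hierarchy

variable {X N : Type*} [Fintype X] [Fintype N] [DecidableEq N]
  (T : Hierarchy X N)

open Classical in
/-- The number of points of `A` below the node `u`. -/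
noncomputable def load (A : Finset X) (u : N) : ℕ := ((T.cluster u).filter (· ∈ A)).card

lemma load_eq_sum (A : Finset X) (u : N) :
    (T.load A u : ℝ) = ∑ x ∈ T.cluster u, (A : Set X).indicator (fun _ => (1 : ℝ)) x := by
  classical
  rw [load, Finset.card_filter]
  push_cast
  refine Finset.sum_congr rfl fun x _ => ?_
  by_cases h : x ∈ A <;> simp [h]

lemma sum_load_children (A : Finset X) {u : N} (hu : ∀ x, u ≠ T.pt x) :
    ∑ v ∈ T.children u, T.load A v = T.load A u := by
  have : ((∑ v ∈ T.children u, T.load A v : ℕ) : ℝ) = T.load A u := by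
    push_cast
    simp only [load_eq_sum]
    exact (T.sum_children u hu _).symm
  exact_mod_cast this

lemma load_root (A : Finset X) : T.load A T.root = A.card := by
  simp [load, T.cluster_root]

lemma load_pt {A : Finset X} {r : X} (hr : r ∈ A) : T.load A (T.pt r) = 1 := by
  simp [load, T.cluster_pt, Finset.filter_singleton, hr]

/-- The allotment vector of an integral configuration. -/
noncomputable def optPoint (k : ℕ) (A : Finset X) (p : N × ℕ) : ℝ :=
  if p.1 = T.root then rootRow k p.2
  else floorVal k + if p.2 < T.load A p.1 then 0 else 5 / 4

lemma optPoint_le_two {k : ℕ} (hk : 1 ≤ k) (A : Finset X) (p : N × ℕ) :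
    T.optPoint k A p ≤ 2 := by
  have := floorVal_le hk
  unfold optPoint
  split_ifs
  · exact rootRow_le_two hk _
  · linarith
  · linarith

lemma optPoint_pt (k : ℕ) {A : Finset X} {r : X} (hr : r ∈ A) :
    T.optPoint k A (T.pt r, 0) = floorVal k := by
  simp [optPoint, T.pt_ne_root, T.load_pt hr]

/-- At an inner node, at most `load u` slots of the children are low. At the root at most `k` are,
and for a set `S` of more than `k` slots the excess `5/4` per high slot gives at least `5/4 * (|S| -
k) ≥ 1/4 + (|S| - k)`, as the root row demands. -/
lemma optPoint_mem {k : ℕ} {A : Finset X} (hA : A.card = k) :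
    T.optPoint k A ∈ T.polytope k := by
  refine ⟨fun p => ?_, fun j => by simp [optPoint], fun u S hS => ?_⟩
  · unfold optPoint
    split_ifs
    · exact floorVal_le_rootRow _ _
    · simp
    · linarith
  rcases S.eq_empty_or_nonempty with rfl | ⟨p₀, hp₀⟩
  · simp
  have hu : ∀ x, u ≠ T.pt x := fun x h => by
    have h1 := hS p₀ hp₀
    exact T.par_ne_pt p₀.1 h1.1 x (h1.2.1.trans h)
  set L := S.filter (fun p => p.2 < T.load A p.1) with hL
  have hLu : L.card ≤ T.load A u := by
    rw [← T.sum_load_children A hu]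
    have hsub : L ⊆ (T.children u).biUnion
        (fun v => (range (T.load A v)).image (fun j => (v, j))) := by
      intro p hp
      obtain ⟨hpS, hpl⟩ := Finset.mem_filter.1 hp
      have h1 := hS p hpS
      simp only [Finset.mem_biUnion, Finset.mem_image, Finset.mem_range]
      exact ⟨p.1, by simp [children, h1.1, h1.2.1], p.2, hpl, rfl⟩
    refine (Finset.card_le_card hsub).trans (Finset.card_biUnion_le.trans ?_)
    refine Finset.sum_le_sum fun v _ => Finset.card_image_le.trans (by simp)
  have hLS : L.card ≤ S.card := Finset.card_filter_le _ _
  have hsum : ∑ p ∈ S, T.optPoint k A p =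
      S.card * floorVal k + 5 / 4 * ((S.card : ℝ) - L.card) := by
    rw [Finset.sum_congr rfl (g := fun p => floorVal k +
      (5 / 4 - if p.2 < T.load A p.1 then (5 / 4 : ℝ) else 0))]
    · rw [Finset.sum_add_distrib, Finset.sum_sub_distrib, ← Finset.sum_filter, ← hL]
      simp
      ring
    · intro p hp
      unfold optPoint
      rw [if_neg (hS p hp).1]
      split_ifs <;> norm_num
  rw [hsum]
  have hLSr : (L.card : ℝ) ≤ S.card := by exact_mod_cast hLS
  by_cases hur : u = T.root
  · subst hur
    rw [T.load_root, hA] at hLu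
    have hLur : (L.card : ℝ) ≤ k := by exact_mod_cast hLu
    simp only [optPoint, if_true]
    rcases le_or_gt S.card k with h | h
    · rw [sum_rootRow_of_le h]
      linarith
    · rw [sum_rootRow_of_lt h]
      have h1 : (k : ℝ) + 1 ≤ S.card := by exact_mod_cast h
      linarith
  · simp only [optPoint, if_neg hur]
    rw [Finset.sum_add_distrib, sum_range_ite_lt]
    simp only [Finset.sum_const, Finset.card_range, nsmul_eq_mul]
    have h1 : ((S.card - min S.card (T.load A u) : ℕ) : ℝ) ≤ (S.card : ℝ) - L.card := by
      rw [← Nat.cast_sub hLS]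
      exact_mod_cast (by omega)
    linarith

lemma div_nonneg {k : ℕ} (hk : 1 ≤ k) {x y : N × ℕ → ℝ} (hx : x ∈ T.polytope k)
    (hy : y ∈ T.polytope k) : 0 ≤ T.div x y :=
  entDiv_nonneg (fun p => (T.w_pos p.1).le) (fun p => (floorVal_pos hk).trans_le (hx.1 p))
    (fun p => (floorVal_pos hk).trans_le (hy.1 p))

/-- The divergence from an integral configuration is Lipschitz in the configuration. -/
lemma div_optPoint_sub_le {k : ℕ} (hk : 1 ≤ k) (A B : Finset X) {y : N × ℕ → ℝ}
    (hy : y ∈ T.polytope k) (hy2 : ∀ p, y p ≤ 2) :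
    T.div (T.optPoint k B) y - T.div (T.optPoint k A) y ≤
      10 * Real.log (k + 1) * ∑ u, T.w u * |(T.load B u : ℝ) - T.load A u| := by
  have hlog : 0 ≤ 10 * Real.log ((k : ℝ) + 1) := by
    have : 0 ≤ Real.log ((k : ℝ) + 1) := Real.log_nonneg (by linarith [Nat.cast_nonneg (α := ℝ) k])
    positivity
  unfold div entDiv
  rw [← Finset.sum_sub_distrib, slots, Finset.sum_product, Finset.mul_sum]
  refine Finset.sum_le_sum fun u _ => ?_
  have key : ∀ j ∈ range (Fintype.card X),
      T.slotWeight (u, j) * relEnt (T.optPoint k B (u, j)) (y (u, j)) -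
      T.slotWeight (u, j) * relEnt (T.optPoint k A (u, j)) (y (u, j)) ≤
      10 * Real.log (k + 1) * T.w u *
        (if (j < T.load B u ↔ j < T.load A u) then (0 : ℝ) else 1) := by
    intro j _
    have hL := abs_relEnt_sub_relEnt_le hk (hy.1 (u, j)) (hy2 (u, j))
    rw [abs_le] at hL
    have hw := T.w_pos u
    rw [← mul_sub, slotWeight, mul_comm (10 * _) (T.w u), mul_assoc]
    refine mul_le_mul_of_nonneg_left ?_ hw.le
    unfold optPoint
    simp only
    by_cases hur : u = T.root
    · simp only [hur, if_true, sub_self]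
      split_ifs <;> simp [hlog]
    · simp only [if_neg hur]
      by_cases h1 : j < T.load B u <;> by_cases h2 : j < T.load A u <;> simp [h1, h2] <;> linarith
  refine (Finset.sum_le_sum key).trans ?_
  rw [← Finset.mul_sum, mul_assoc (10 * _)]
  refine mul_le_mul_of_nonneg_left ?_ hlog
  exact mul_le_mul_of_nonneg_left (sum_range_ite_iff_le _ _ _) (T.w_pos u).le

lemma movement_triangle (x y z : N × ℕ → ℝ) :
    T.movement x z ≤ T.movement x y + T.movement y z := by
  unfold movement
  rw [← Finset.sum_add_distrib]
  refine Finset.sum_le_sum fun p _ => ?_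
  rw [← mul_add]
  exact mul_le_mul_of_nonneg_left (abs_sub_le _ _ _) (T.w_pos p.1).le

/-- Serving a request by finitely many projection steps. -/
theorem exists_serving_point {k : ℕ} (hk : 1 ≤ k) (hX : k ≤ Fintype.card X) {m : ℕ}
    (hm : ∀ u, T.depth u ≤ m) (z : N × ℕ → ℝ) (hz : z ∈ T.polytope k) (hz2 : ∀ p, z p ≤ 2)
    (r : X) :
    ∃ y ∈ T.polytope k, (∀ p, y p ≤ 2) ∧ y (T.pt r, 0) ≤ 2 * floorVal k ∧ ∃ G : ℝ, 0 ≤ G ∧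
      (∀ x ∈ T.polytope k, x (T.pt r, 0) = floorVal k → T.div x y + G ≤ T.div x z) ∧
      T.movement z y ≤ T.linPot y - T.linPot z + 16 * m * G := by
  obtain ⟨c, hc, hstep⟩ := T.exists_projection_step hk hm
  obtain ⟨A, hrA, hA⟩ : ∃ A : Finset X, r ∈ A ∧ A.card = k := by
    obtain ⟨A, h1, -, h3⟩ := Finset.exists_subsuperset_card_eq
      (Finset.subset_univ {r}) (by simpa using hk) (by simpa using hX)
    exact ⟨A, h1 (Finset.mem_singleton_self r), h3⟩
  set x₀ := T.optPoint k A with hx₀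
  have hx₀P : x₀ ∈ T.polytope k := T.optPoint_mem hA
  -- Each step lowers the nonnegative divergence from one fixed serving vector `x₀` by at least `c`,
  -- so the number of steps is bounded by induction on `n`.
  have main : ∀ n : ℕ, ∀ z ∈ T.polytope k, (∀ p, z p ≤ 2) → T.div x₀ z < n * c →
      ∃ y ∈ T.polytope k, (∀ p, y p ≤ 2) ∧ y (T.pt r, 0) ≤ 2 * floorVal k ∧ ∃ G : ℝ, 0 ≤ G ∧
      (∀ x ∈ T.polytope k, x (T.pt r, 0) = floorVal k → T.div x y + G ≤ T.div x z) ∧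
      T.movement z y ≤ T.linPot y - T.linPot z + 16 * m * G := by
    intro n
    induction n with
    | zero =>
      intro z hz _ h
      have := T.div_nonneg hk hx₀P hz
      simp at h
      linarith
    | succ n ih =>
      intro z hz hz2 h
      rcases le_or_gt (z (T.pt r, 0)) (2 * floorVal k) with hle | hlt
      · refine ⟨z, hz, hz2, hle, 0, le_rfl, fun _ _ _ => by simp, ?_⟩
        simp [movement]
      · obtain ⟨y₁, hy₁, hy₁2, G₁, hcG, hdiv, hmov⟩ := hstep z hz hz2 r hlt
        have h1 := hdiv x₀ hx₀P (T.optPoint_pt k hrA)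
        push_cast at h
        obtain ⟨y, hy, hy2, hyr, G, hG, hdiv', hmov'⟩ := ih y₁ hy₁ hy₁2 (by linarith)
        refine ⟨y, hy, hy2, hyr, G₁ + G, by linarith, fun x hx hxr => ?_, ?_⟩
        · linarith [hdiv x hx hxr, hdiv' x hx hxr]
        · have := T.movement_triangle z y₁ y
          linarith
  obtain ⟨n, hn⟩ := exists_nat_gt (T.div x₀ z / c)
  exact main n z hz hz2 (by rwa [div_lt_iff₀ hc] at hn)

/-! ### Server capacities -/

/-- A bound on the number of servers that an allotment vector permits below a node. -/
noncomputable def capTerm (k : ℕ) (y : N × ℕ → ℝ) (u : N) (m : ℕ) : ℝ :=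
  min (m : ℝ) (∑ j ∈ range m, (1 - 1 / (1 - floorVal k) * (y (u, j) - 2 * floorVal k)))

/-- The number of servers that an allotment vector permits below a node. -/
noncomputable def capacity (k : ℕ) (y : N × ℕ → ℝ) (u : N) : ℝ :=
  (range ((T.cluster u).card + 1)).sup' ⟨0, by simp⟩ (capTerm k y u)

lemma capTerm_le_capacity (k : ℕ) (y : N × ℕ → ℝ) {u : N} {m : ℕ} (hm : m ≤ (T.cluster u).card) :
    capTerm k y u m ≤ T.capacity k y u :=
  Finset.le_sup' (capTerm k y u) (Finset.mem_range.2 (Nat.lt_succ_of_le hm))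

lemma exists_capacity_eq (k : ℕ) (y : N × ℕ → ℝ) (u : N) :
    ∃ m ≤ (T.cluster u).card, T.capacity k y u = capTerm k y u m := by
  obtain ⟨m, hm, h⟩ := Finset.exists_mem_eq_sup' (s := range ((T.cluster u).card + 1))
    ⟨0, by simp⟩ (capTerm k y u)
  exact ⟨m, Nat.lt_succ_iff.1 (Finset.mem_range.1 hm), h⟩

lemma capacity_nonneg (k : ℕ) (y : N × ℕ → ℝ) (u : N) : 0 ≤ T.capacity k y u := by
  have := T.capTerm_le_capacity k y (u := u) (m := 0) (Nat.zero_le _)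
  simpa [capTerm] using this

/-- The shift by `2 * floorVal k` in `capTerm` makes the stopping threshold of the projection count
as a full server. -/
lemma one_le_capacity_pt {k : ℕ} (hk : 1 ≤ k) {y : N × ℕ → ℝ} {r : X}
    (hr : y (T.pt r, 0) ≤ 2 * floorVal k) : 1 ≤ T.capacity k y (T.pt r) := by
  have h1 := T.capTerm_le_capacity k y (u := T.pt r) (m := 1) (by simp [T.cluster_pt])
  refine le_trans ?_ h1
  have hδ := floorVal_le hk
  have h2 : 0 ≤ 1 / (1 - floorVal k) * (2 * floorVal k - y (T.pt r, 0)) :=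
    mul_nonneg (by apply one_div_nonneg.2; linarith) (by linarith)
  simp only [capTerm, Nat.cast_one, Finset.sum_range_one]
  refine le_min le_rfl ?_
  linarith

/-- For `m ≤ k` the bound `m` in the minimum suffices. For `m > k` the sum equals `k` exactly, by
the choice of the root row and of the factor `1 / (1 - floorVal k)`. -/
lemma capacity_root_le {k : ℕ} (hk : 1 ≤ k) {y : N × ℕ → ℝ} (hy : y ∈ T.polytope k) :
    T.capacity k y T.root ≤ k := by
  obtain ⟨m, -, hm⟩ := T.exists_capacity_eq k y T.root
  rw [hm]
  rcases le_or_gt m k with h | h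
  · exact (min_le_left _ _).trans (by exact_mod_cast h)
  · refine (min_le_right _ _).trans ?_
    simp only [hy.2.1]
    rw [Finset.sum_sub_distrib, ← Finset.mul_sum, Finset.sum_sub_distrib, sum_rootRow_of_lt h]
    simp only [Finset.sum_const, Finset.card_range, nsmul_eq_mul, mul_one]
    have h1 := mul_floorVal hk
    have h2 := floorVal_le hk
    have h3 : 1 - floorVal k ≠ 0 := by linarith
    have h4 : (m * floorVal k + 1 / 4 + (m - k) - m * (2 * floorVal k) : ℝ) =
        (1 - floorVal k) * (m - k) := by rw [← h1]; ring
    rw [h4, ← mul_assoc, one_div_mul_cancel h3]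
    linarith

/-- If `m v` attains the capacity of the child `v`, the first `m v` slots of all children form a set
to which the polytope constraint at `u` applies. -/
lemma sum_capacity_children_le {k : ℕ} (hk : 1 ≤ k) {y : N × ℕ → ℝ} (hy : y ∈ T.polytope k)
    {u : N} (hu : ∀ x, u ≠ T.pt x) :
    ∑ v ∈ T.children u, T.capacity k y v ≤ T.capacity k y u := by
  choose m hm hcap using T.exists_capacity_eq k y
  have hcard : ∑ v ∈ T.children u, (T.cluster v).card = (T.cluster u).card := by
    have := T.sum_children u hu (fun _ => 1)
    simp only [Finset.sum_const, nsmul_eq_mul, mul_one] at this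
    exact_mod_cast this.symm
  set M := ∑ v ∈ T.children u, m v with hM
  have hMle : M ≤ (T.cluster u).card := by
    rw [← hcard]; exact Finset.sum_le_sum fun v _ => hm v
  refine le_trans ?_ (T.capTerm_le_capacity k y hMle)
  simp only [hcap]
  refine le_min ?_ ?_
  · rw [hM]
    push_cast
    exact Finset.sum_le_sum fun v _ => min_le_left _ _
  · refine (Finset.sum_le_sum fun v _ => min_le_right _ _).trans ?_
    set A : Finset (N × ℕ) := ((T.children u).sigma (fun v => range (m v))).map
      ⟨fun p => (p.1, p.2), fun p q h => by
        obtain ⟨a, b⟩ := p; obtain ⟨c, d⟩ := q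
        simp only [Prod.mk.injEq] at h
        obtain ⟨rfl, rfl⟩ := h; rfl⟩ with hA
    have hAc : A.card = M := by simp [hA, hM]
    have hAs : ∑ p ∈ A, y p = ∑ v ∈ T.children u, ∑ j ∈ range (m v), y (v, j) := by
      rw [hA, Finset.sum_map, Finset.sum_sigma]; rfl
    have h1 := hy.2.2 u A (by
      intro p hp
      simp only [hA, Finset.mem_map, Finset.mem_sigma, Finset.mem_range] at hp
      obtain ⟨q, ⟨hq1, hq2⟩, rfl⟩ := hp
      simp only [children, Finset.mem_filter, Finset.mem_univ, true_and] at hq1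
      exact ⟨hq1.1, hq1.2, hq2.trans_le (hm _)⟩)
    rw [hAs, hAc] at h1
    have hβ : 0 ≤ 1 / (1 - floorVal k) := one_div_nonneg.2 (by linarith [floorVal_le hk])
    simp only [Finset.sum_sub_distrib, ← Finset.mul_sum, Finset.sum_const, Finset.card_range,
      nsmul_eq_mul, mul_one]
    rw [← Finset.sum_mul, ← Nat.cast_sum, ← hM]
    have := mul_le_mul_of_nonneg_left h1 hβ
    linarith

lemma capacity_sub_le {k : ℕ} (hk : 1 ≤ k) (y z : N × ℕ → ℝ) (u : N) :
    T.capacity k y u - T.capacity k z u ≤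
      2 * ∑ j ∈ range (Fintype.card X), |y (u, j) - z (u, j)| := by
  obtain ⟨m, hm, hcap⟩ := T.exists_capacity_eq k y u
  have h1 := T.capTerm_le_capacity k z hm
  rw [hcap]
  suffices h : capTerm k y u m ≤ capTerm k z u m +
      2 * ∑ j ∈ range (Fintype.card X), |y (u, j) - z (u, j)| by linarith
  have h2 : ∑ j ∈ range m, (1 - 1 / (1 - floorVal k) * (y (u, j) - 2 * floorVal k)) ≤
      ∑ j ∈ range m, (1 - 1 / (1 - floorVal k) * (z (u, j) - 2 * floorVal k)) +
      2 * ∑ j ∈ range (Fintype.card X), |y (u, j) - z (u, j)| := by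
    have h3 : ∑ j ∈ range m, |y (u, j) - z (u, j)| ≤
        ∑ j ∈ range (Fintype.card X), |y (u, j) - z (u, j)| :=
      Finset.sum_le_sum_of_subset_of_nonneg
        (Finset.range_mono (hm.trans (Finset.card_le_univ _))) fun _ _ _ => abs_nonneg _
    have h4 : ∑ j ∈ range m, (1 - 1 / (1 - floorVal k) * (y (u, j) - 2 * floorVal k)) ≤
        ∑ j ∈ range m, ((1 - 1 / (1 - floorVal k) * (z (u, j) - 2 * floorVal k)) +
        2 * |y (u, j) - z (u, j)|) := by
      refine Finset.sum_le_sum fun j _ => ?_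
      have hβ0 : 0 ≤ 1 / (1 - floorVal k) := one_div_nonneg.2 (by linarith [floorVal_le hk])
      have hβ : 1 / (1 - floorVal k) ≤ 2 := by
        rw [div_le_iff₀ (by linarith [floorVal_le hk])]
        linarith [floorVal_le hk]
      have h5 := neg_abs_le (y (u, j) - z (u, j))
      have h6 := abs_nonneg (y (u, j) - z (u, j))
      nlinarith
    rw [Finset.sum_add_distrib, ← Finset.mul_sum] at h4
    linarith
  have h3 : 0 ≤ 2 * ∑ j ∈ range (Fintype.card X), |y (u, j) - z (u, j)| := by positivity
  unfold capTerm
  rw [← min_add_add_right]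
  exact le_min ((min_le_left _ _).trans (by linarith)) ((min_le_right _ _).trans h2)

lemma sum_abs_capacity_sub_le {k : ℕ} (hk : 1 ≤ k) (y z : N × ℕ → ℝ) :
    ∑ u, T.w u * |T.capacity k y u - T.capacity k z u| ≤ 2 * T.movement y z := by
  unfold movement
  rw [slots, Finset.sum_product, Finset.mul_sum]
  refine Finset.sum_le_sum fun u _ => ?_
  simp only [slotWeight]
  rw [← Finset.mul_sum, mul_left_comm]
  refine mul_le_mul_of_nonneg_left ?_ (T.w_pos u).le
  rw [abs_le]
  constructor
  · have := T.capacity_sub_le hk z y u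
    simp only [abs_sub_comm (z _)] at this
    linarith
  · exact T.capacity_sub_le hk y z u

end Hierarchy

/-! ### Transport plans -/

section Transport

variable {X : Type*} [Fintype X]

/-- The cost of a transport plan. -/
noncomputable def planCost [MetricSpace X] (π : X → X → ℝ) : ℝ := ∑ x, ∑ y, π x y * dist x y

lemma earthmover_le [MetricSpace X] {z z' : X → ℝ} {π : X → X → ℝ} (h : IsTransportPlan z z' π) :
    earthmover z z' ≤ planCost π := by
  refine csInf_le ⟨0, ?_⟩ ⟨π, h, rfl⟩
  rintro c ⟨π, hπ, rfl⟩
  exact Finset.sum_nonneg fun x _ => Finset.sum_nonneg fun y _ =>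
    mul_nonneg (hπ.nonneg x y) dist_nonneg

lemma IsTransportPlan.diag {z : X → ℝ} (hz : ∀ x, 0 ≤ z x) [DecidableEq X] :
    IsTransportPlan z z (fun x y => if x = y then z x else 0) where
  nonneg x y := by split_ifs <;> simp [hz]
  source x := by simp
  target y := by simp

lemma planCost_diag [MetricSpace X] [DecidableEq X] (z : X → ℝ) :
    planCost (fun x y => if x = y then z x else 0) = 0 := by
  refine Finset.sum_eq_zero fun x _ => Finset.sum_eq_zero fun y _ => ?_
  by_cases h : x = y <;> simp [h]

lemma exists_isTransportPlan {z z' : X → ℝ} {k : ℝ} (hk : 0 < k) (hz : ∀ x, 0 ≤ z x)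
    (hz' : ∀ x, 0 ≤ z' x) (hs : ∑ x, z x = k) (hs' : ∑ x, z' x = k) :
    ∃ π, IsTransportPlan z z' π := by
  refine ⟨fun x y => z x * z' y / k, fun x y => ?_, fun x => ?_, fun y => ?_⟩
  · exact div_nonneg (mul_nonneg (hz x) (hz' y)) hk.le
  · rw [← Finset.sum_div, ← Finset.mul_sum, hs', mul_div_assoc, div_self hk.ne', mul_one]
  · rw [← Finset.sum_div, ← Finset.sum_mul, hs, mul_comm, mul_div_assoc, div_self hk.ne', mul_one]

/-- Redirecting the mass `ε` that arrives at `a` to `r`. -/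
lemma IsTransportPlan.redirect [MetricSpace X] [DecidableEq X] {z z' : X → ℝ} {π : X → X → ℝ}
    (h : IsTransportPlan z z' π) {a r : X} {ε : ℝ} (hε : 0 ≤ ε) (ha : 0 < z' a) (hεa : ε ≤ z' a) :
    ∃ π', IsTransportPlan z (fun x => z' x + ε * ((if x = r then 1 else 0) -
      if x = a then 1 else 0)) π' ∧ planCost π' ≤ planCost π + ε * dist a r := by
  -- The same proportion `ε / z' a` of every flow into `a` is sent on to `r`.
  refine ⟨fun x y => π x y + ε * (π x a / z' a) * ((if y = r then 1 else 0) -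
      if y = a then 1 else 0), ⟨fun x y => ?_, fun x => ?_, fun y => ?_⟩, ?_⟩
  · have h1 : ε * (π x a / z' a) ≤ π x a := by
      rw [mul_div_assoc', div_le_iff₀ ha, mul_comm]
      exact mul_le_mul_of_nonneg_left hεa (h.nonneg x a)
    have h2 : 0 ≤ ε * (π x a / z' a) := mul_nonneg hε (div_nonneg (h.nonneg x a) ha.le)
    have h3 := h.nonneg x y
    by_cases hya : y = a
    · subst hya
      simp only [if_true]
      split_ifs <;> linarith
    · simp only [if_neg hya]
      split_ifs <;> linarith
  · rw [Finset.sum_add_distrib, h.source, ← Finset.mul_sum]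
    simp
  · rw [Finset.sum_add_distrib, h.target, ← Finset.sum_mul, ← Finset.mul_sum, ← Finset.sum_div,
      h.target, div_self ha.ne', mul_one]
  · unfold planCost
    have h1 : ∀ x, ∑ y, (π x y + ε * (π x a / z' a) * ((if y = r then 1 else 0) -
        if y = a then 1 else 0)) * dist x y ≤
        ∑ y, π x y * dist x y + ε * (π x a / z' a) * dist a r := by
      intro x
      have h2 : ∑ y, (π x y + ε * (π x a / z' a) * ((if y = r then 1 else 0) -
          if y = a then 1 else 0)) * dist x y = ∑ y, π x y * dist x y +
          ε * (π x a / z' a) * (dist x r - dist x a) := by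
        simp only [add_mul, Finset.sum_add_distrib]
        congr 1
        simp only [mul_assoc, ← Finset.mul_sum, sub_mul, Finset.sum_sub_distrib, ite_mul, one_mul,
          zero_mul, Finset.sum_ite_eq', Finset.mem_univ, if_true]
      rw [h2]
      refine add_le_add le_rfl (mul_le_mul_of_nonneg_left ?_
        (mul_nonneg hε (div_nonneg (h.nonneg x a) ha.le)))
      linarith [dist_triangle x a r]
    refine (Finset.sum_le_sum fun x _ => h1 x).trans ?_
    rw [Finset.sum_add_distrib, ← Finset.sum_mul, ← Finset.mul_sum, ← Finset.sum_div, h.target,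
      div_self ha.ne', mul_one]

end Transport

/-! ### Lazy movement of mass in the tree -/

namespace Hierarchy

variable {X N : Type*} [Fintype X] [Fintype N] [DecidableEq N] (T : Hierarchy X N)

/-- The mass below a node. -/
def mass (z : X → ℝ) (u : N) : ℝ := ∑ x ∈ T.cluster u, z x

/-- The weighted distance between the subtree masses of `z` and the values `F`. -/
noncomputable def pot (z : X → ℝ) (F : N → ℝ) : ℝ := ∑ u, T.w u * |T.mass z u - F u|

/-- The tree distance of two points. -/
noncomputable def nodeDist (x y : X) : ℝ :=
  ∑ u, T.w u * |(T.cluster u : Set X).indicator (fun _ => (1 : ℝ)) x -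
    (T.cluster u : Set X).indicator (fun _ => (1 : ℝ)) y|

lemma mass_pt (z : X → ℝ) (x : X) : T.mass z (T.pt x) = z x := by
  simp [mass, T.cluster_pt]

lemma mem_cluster_pt (x : X) : x ∈ T.cluster (T.pt x) := by simp [T.cluster_pt]

lemma sum_mass_children (z : X → ℝ) {u : N} (hu : ∀ x, u ≠ T.pt x) :
    ∑ v ∈ T.children u, T.mass z v = T.mass z u :=
  (T.sum_children u hu z).symm

lemma exists_child_mem {u : N} (hu : ∀ x, u ≠ T.pt x) {a : X} (ha : a ∈ T.cluster u) :
    ∃ v ∈ T.children u, a ∈ T.cluster v := by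
  classical
  by_contra! h
  have h1 := T.sum_mass_children (fun x => if x = a then 1 else 0) hu
  simp only [mass, Finset.sum_ite_eq', if_pos ha] at h1
  rw [Finset.sum_eq_zero fun v hv => by rw [if_neg (h v hv)]] at h1
  exact zero_ne_one h1

lemma depth_child {u v : N} (hv : v ∈ T.children u) : T.depth v = T.depth u + 1 := by
  simp only [children, Finset.mem_filter, Finset.mem_univ, true_and] at hv
  rw [T.depth_par v hv.1, hv.2]

lemma mem_cluster_par {x : X} {u : N} (hu : u ≠ T.root) (hx : x ∈ T.cluster u) :
    x ∈ T.cluster (T.par u) := by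
  classical
  by_contra h
  have h1 := T.sum_mass_children (fun y => if y = x then 1 else 0) (T.par_ne_pt u hu)
  simp only [mass, Finset.sum_ite_eq', if_neg h] at h1
  have h2 : (1 : ℝ) ≤ ∑ v ∈ T.children (T.par u), if x ∈ T.cluster v then 1 else 0 := by
    have h3 := Finset.single_le_sum (f := fun v => if x ∈ T.cluster v then (1 : ℝ) else 0)
      (s := T.children (T.par u)) (a := u) (fun v _ => by split_ifs <;> norm_num)
      (by simp [children, hu])
    simpa [hx] using h3
  linarith

/-- A deeper node containing `x` would have an ancestor whose parent is the leaf `pt x`, but leaves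
have no children. -/
lemma depth_le_pt {x : X} {u : N} (hx : x ∈ T.cluster u) : T.depth u ≤ T.depth (T.pt x) := by
  have climb : ∀ (d : ℕ) (u : N), x ∈ T.cluster u → T.depth u = T.depth (T.pt x) + d + 1 →
      False := by
    intro d
    induction d with
    | zero =>
      intro u hx hd
      have hur : u ≠ T.root := by rintro rfl; rw [T.depth_root] at hd; omega
      have h1 := T.depth_par u hur
      exact T.par_ne_pt u hur x (T.eq_of_mem_cluster x _ _ (T.mem_cluster_par hur hx)
        (T.mem_cluster_pt x) (by omega))
    | succ d ih =>
      intro u hx hd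
      have hur : u ≠ T.root := by rintro rfl; rw [T.depth_root] at hd; omega
      have h1 := T.depth_par u hur
      exact ih _ (T.mem_cluster_par hur hx) (by omega)
  by_contra! h
  exact climb (T.depth u - T.depth (T.pt x) - 1) u hx (by omega)

lemma exists_child_lt {z : X → ℝ} {F : N → ℝ} {u : N} (hu : ∀ x, u ≠ T.pt x)
    (hsup : ∑ v ∈ T.children u, F v ≤ F u) (h : F u < T.mass z u) :
    ∃ v ∈ T.children u, F v < T.mass z v := by
  by_contra! hc
  have := Finset.sum_le_sum hc
  rw [T.sum_mass_children z hu] at this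
  linarith

/-- Below a node with excess mass there is a point all of whose ancestors up to this node
have excess mass. -/
lemma exists_source_below {z : X → ℝ} {F : N → ℝ}
    (hsup : ∀ u, (∀ x, u ≠ T.pt x) → ∑ v ∈ T.children u, F v ≤ F u) {m : ℕ}
    (hm : ∀ u, T.depth u ≤ m) :
    ∀ (n : ℕ) (v : N), m - T.depth v ≤ n → F v < T.mass z v →
      ∃ a ∈ T.cluster v, ∀ u, a ∈ T.cluster u → T.depth v ≤ T.depth u → F u < T.mass z u := by
  intro n
  induction n with
  | zero =>
    intro v hv h
    by_cases hpt : ∃ x, v = T.pt x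
    · obtain ⟨x, rfl⟩ := hpt
      refine ⟨x, T.mem_cluster_pt x, fun u hu hd => ?_⟩
      rwa [T.eq_of_mem_cluster x u _ hu (T.mem_cluster_pt x) (le_antisymm (T.depth_le_pt hu) hd)]
    · push Not at hpt
      obtain ⟨c, hc, -⟩ := T.exists_child_lt hpt (hsup v hpt) h
      have h1 := T.depth_child hc
      have := hm c
      omega
  | succ n ih =>
    intro v hv h
    by_cases hpt : ∃ x, v = T.pt x
    · obtain ⟨x, rfl⟩ := hpt
      refine ⟨x, T.mem_cluster_pt x, fun u hu hd => ?_⟩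
      rwa [T.eq_of_mem_cluster x u _ hu (T.mem_cluster_pt x) (le_antisymm (T.depth_le_pt hu) hd)]
    · push Not at hpt
      obtain ⟨c, hc, hlt⟩ := T.exists_child_lt hpt (hsup v hpt) h
      have h1 := T.depth_child hc
      obtain ⟨a, ha, hall⟩ := ih c (by omega) hlt
      have hc' := hc
      simp only [children, Finset.mem_filter, Finset.mem_univ, true_and] at hc'
      have hav : a ∈ T.cluster v := hc'.2 ▸ T.mem_cluster_par hc'.1 ha
      refine ⟨a, hav, fun u hu hd => ?_⟩
      rcases hd.eq_or_lt with h2 | h2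
      · rwa [← T.eq_of_mem_cluster a v u hav hu h2]
      · exact hall u hu (by omega)

/-- If `r` has too little mass, there is a point `a` from which mass can be moved to `r` so that
every edge on the way carries flow in the right direction. -/
lemma exists_source {z : X → ℝ} {F : N → ℝ}
    (hsup : ∀ u, (∀ x, u ≠ T.pt x) → ∑ v ∈ T.children u, F v ≤ F u)
    (hroot : F T.root ≤ T.mass z T.root) {r : X} (hr : z r < F (T.pt r)) :
    ∃ a, F (T.pt a) < z a ∧ (∀ u, r ∈ T.cluster u → a ∉ T.cluster u → T.mass z u < F u) ∧
      ∀ u, a ∈ T.cluster u → r ∉ T.cluster u → F u < T.mass z u := by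
  classical
  obtain ⟨m, hm⟩ : ∃ m, ∀ u, T.depth u ≤ m :=
    ⟨Finset.univ.sup T.depth, fun u => Finset.le_sup (f := T.depth) (Finset.mem_univ u)⟩
  -- `p` is the deepest ancestor of `r` without deficit. Its child towards `r` has a deficit, so
  -- superadditivity forces another child with excess, and excess descends to a leaf `a`.
  obtain ⟨p, hp, hmax⟩ := Finset.exists_max_image
    (Finset.univ.filter (fun u => r ∈ T.cluster u ∧ F u ≤ T.mass z u)) T.depth
    ⟨T.root, by simp [T.cluster_root, hroot]⟩
  simp only [Finset.mem_filter, Finset.mem_univ, true_and] at hp hmax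
  have hpt : ∀ x, p ≠ T.pt x := by
    rintro x rfl
    have hxr : r = x := by simpa [T.cluster_pt] using hp.1
    subst hxr
    rw [T.mass_pt] at hp
    linarith [hp.2]
  obtain ⟨c, hc, hrc⟩ := T.exists_child_mem hpt hp.1
  have hcd := T.depth_child hc
  have hcF : T.mass z c < F c := by
    by_contra! h
    have := hmax c ⟨hrc, h⟩
    omega
  obtain ⟨v, hv, hvF⟩ : ∃ v ∈ T.children p, F v < T.mass z v := by
    by_contra! h
    have h1 := Finset.sum_lt_sum h ⟨c, hc, hcF⟩
    rw [T.sum_mass_children z hpt] at h1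
    linarith [hsup p hpt, hp.2]
  have hvd := T.depth_child hv
  obtain ⟨a, ha, hall⟩ := T.exists_source_below hsup hm _ v le_rfl hvF
  have hv' := hv
  simp only [children, Finset.mem_filter, Finset.mem_univ, true_and] at hv'
  have hap : a ∈ T.cluster p := hv'.2 ▸ T.mem_cluster_par hv'.1 ha
  refine ⟨a, ?_, fun u hu hau => ?_, fun u hu hru => ?_⟩
  · rw [← T.mass_pt z a]
    exact hall _ (T.mem_cluster_pt a) (T.depth_le_pt ha)
  · by_contra! h
    exact hau (T.cluster_subset r u p hu hp.1 (hmax u ⟨hu, h⟩) hap)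
  · refine hall u hu ?_
    by_contra! h
    exact hru (T.cluster_subset a u p hu hap (by omega) hp.1)

lemma pot_nonneg (z : X → ℝ) (F : N → ℝ) : 0 ≤ T.pot z F :=
  Finset.sum_nonneg fun u _ => mul_nonneg (T.w_pos u).le (abs_nonneg _)

lemma pot_le_pot_add (z : X → ℝ) (F F' : N → ℝ) :
    T.pot z F' ≤ T.pot z F + ∑ u, T.w u * |F u - F' u| := by
  unfold pot
  rw [← Finset.sum_add_distrib]
  refine Finset.sum_le_sum fun u _ => ?_
  rw [← mul_add]
  exact mul_le_mul_of_nonneg_left (abs_sub_le _ _ _) (T.w_pos u).le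

lemma mass_add_single [DecidableEq X] (z : X → ℝ) (a r : X) (ε : ℝ) (u : N) :
    T.mass (fun x => z x + ε * ((if x = r then 1 else 0) - if x = a then 1 else 0)) u =
      T.mass z u + ε * ((if r ∈ T.cluster u then 1 else 0) - if a ∈ T.cluster u then 1 else 0) := by
  unfold mass
  rw [Finset.sum_add_distrib, ← Finset.mul_sum, Finset.sum_sub_distrib, Finset.sum_ite_eq',
    Finset.sum_ite_eq']

/-- A small movement from `a` to `r` decreases the potential at the rate of their distance. -/
lemma exists_pot_decrease [DecidableEq X] {z : X → ℝ} {F : N → ℝ} {a r : X}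
    (h1 : ∀ u, r ∈ T.cluster u → a ∉ T.cluster u → T.mass z u < F u)
    (h2 : ∀ u, a ∈ T.cluster u → r ∉ T.cluster u → F u < T.mass z u) {b : ℝ} (hb : 0 < b) :
    ∃ ε, 0 < ε ∧ ε ≤ b ∧
      T.pot (fun x => z x + ε * ((if x = r then 1 else 0) - if x = a then 1 else 0)) F ≤
        T.pot z F - ε * T.nodeDist a r := by
  -- Strict excess or deficit on finitely many edges leaves room for a positive amount that
  -- overshoots none of them.
  have hev : ∀ᶠ ε : ℝ in 𝓝[>] 0, ∀ u : N,
      (r ∈ T.cluster u → a ∉ T.cluster u → ε ≤ F u - T.mass z u) ∧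
      (a ∈ T.cluster u → r ∉ T.cluster u → ε ≤ T.mass z u - F u) := by
    rw [Filter.eventually_all]
    intro u
    refine Filter.Eventually.and ?_ ?_
    · by_cases h : r ∈ T.cluster u ∧ a ∉ T.cluster u
      · filter_upwards [Ioc_mem_nhdsGT (sub_pos.2 (h1 u h.1 h.2))] with ε hε _ _ using hε.2
      · exact Filter.Eventually.of_forall fun ε hr ha => absurd ⟨hr, ha⟩ h
    · by_cases h : a ∈ T.cluster u ∧ r ∉ T.cluster u
      · filter_upwards [Ioc_mem_nhdsGT (sub_pos.2 (h2 u h.1 h.2))] with ε hε _ _ using hε.2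
      · exact Filter.Eventually.of_forall fun ε hr ha => absurd ⟨hr, ha⟩ h
  obtain ⟨ε, hε, hεb⟩ := (hev.and (Ioc_mem_nhdsGT hb)).exists
  refine ⟨ε, hεb.1, hεb.2, ?_⟩
  unfold pot nodeDist
  rw [Finset.mul_sum, ← Finset.sum_sub_distrib]
  refine Finset.sum_le_sum fun u _ => ?_
  rw [T.mass_add_single, mul_left_comm ε, ← mul_sub]
  refine mul_le_mul_of_nonneg_left ?_ (T.w_pos u).le
  have h3 := hε u
  by_cases hr : r ∈ T.cluster u <;> by_cases ha : a ∈ T.cluster u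
  · simp [hr, ha]
  · have h4 := h3.1 hr ha
    have h5 := hεb.1
    simp only [hr, ha, Finset.mem_coe, not_false_eq_true, Set.indicator_of_mem,
      Set.indicator_of_notMem, if_true, if_false]
    rw [abs_of_nonpos (by linarith), abs_of_nonpos (by linarith)]
    norm_num
  · have h4 := h3.2 ha hr
    have h5 := hεb.1
    simp only [hr, ha, Finset.mem_coe, not_false_eq_true, Set.indicator_of_mem,
      Set.indicator_of_notMem, if_true, if_false]
    rw [abs_of_nonneg (by linarith), abs_of_nonneg (by linarith)]
    norm_num
    linarith
  · simp [hr, ha]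

/-- Lazy movement: if the capacity at `r` is at least `1`, the mass at `r` can be raised to `1`
at a cost that is paid by the decrease of the potential. -/
theorem exists_lazy_move [MetricSpace X] (hdist : ∀ x y, dist x y ≤ T.nodeDist x y) {k : ℕ}
    {z : X → ℝ} (hz : IsFractionalConfig k z) {F : N → ℝ} (hF : ∀ u, 0 ≤ F u)
    (hsup : ∀ u, (∀ x, u ≠ T.pt x) → ∑ v ∈ T.children u, F v ≤ F u)
    (hroot : F T.root ≤ k) {r : X} (hr : 1 ≤ F (T.pt r)) :
    ∃ z', IsFractionalConfig k z' ∧ z' r = 1 ∧ earthmover z z' + T.pot z' F ≤ T.pot z F := by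
  classical
  set tgt : (X → X → ℝ) → X → ℝ := fun π y => ∑ x, π x y with htgt
  -- Plans from `z` whose cost is already paid by the decrease of the potential. Maximizing the mass
  -- at `r` over this compact set replaces a continuous-time movement.
  set K : Set (X → X → ℝ) := {π | (∀ x y, 0 ≤ π x y) ∧ (∀ x, ∑ y, π x y = z x) ∧
    (∀ y, tgt π y ≤ 1) ∧ planCost π + T.pot (tgt π) F ≤ T.pot z F} with hK
  have hc : ∀ x y : X, Continuous fun π : X → X → ℝ => π x y := fun x y => by fun_prop
  have hct : ∀ y : X, Continuous fun π : X → X → ℝ => tgt π y := fun y =>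
    continuous_finsetSum _ fun x _ => hc x y
  have hclosed : IsClosed K := by
    simp only [hK, Set.ofPred_and, Set.ofPred_forall]
    refine (isClosed_iInter fun x => isClosed_iInter fun y => isClosed_le continuous_const
      (hc x y)).inter ((isClosed_iInter fun x => isClosed_eq
      (continuous_finsetSum _ fun y _ => hc x y) continuous_const).inter
      ((isClosed_iInter fun y => isClosed_le (hct y) continuous_const).inter
      (isClosed_le ?_ continuous_const)))
    refine Continuous.add ?_ ?_
    · exact continuous_finsetSum _ fun x _ => continuous_finsetSum _ fun y _ =>
        (hc x y).mul continuous_const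
    · refine continuous_finsetSum _ fun u _ => continuous_const.mul (Continuous.abs ?_)
      exact (continuous_finsetSum _ fun y _ => hct y).sub continuous_const
  have hcomp : IsCompact K := by
    refine IsCompact.of_isClosed_subset (isCompact_univ_pi fun x : X =>
      isCompact_univ_pi fun y : X => isCompact_Icc (a := (0 : ℝ)) (b := 1)) hclosed ?_
    rintro π ⟨h1, h2, -, -⟩ x - y -
    refine ⟨h1 x y, ?_⟩
    refine (Finset.single_le_sum (f := fun y => π x y) (fun y _ => h1 x y)
      (Finset.mem_univ y)).trans ?_
    rw [h2]
    exact hz.le_one x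
  have hne : K.Nonempty := by
    have hd := IsTransportPlan.diag hz.nonneg
    have ht : tgt (fun x y => if x = y then z x else 0) = z := by
      ext y; exact hd.target y
    refine ⟨fun x y => if x = y then z x else 0, hd.nonneg, hd.source, fun y => ?_, ?_⟩
    · rw [ht]; exact hz.le_one y
    · rw [ht, planCost_diag, zero_add]
  obtain ⟨π, hπ, hmax⟩ := hcomp.exists_isMaxOn hne (hct r).continuousOn
  obtain ⟨h1, h2, h3, h4⟩ := hπ
  have hplan : IsTransportPlan z (tgt π) π := ⟨h1, h2, fun y => rfl⟩
  have hsum : ∑ y, tgt π y = k := by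
    rw [htgt]
    simp only
    rw [Finset.sum_comm]
    simp only [h2]
    exact hz.sum_eq
  have hnn : ∀ y, 0 ≤ tgt π y := fun y => Finset.sum_nonneg fun x _ => h1 x y
  refine ⟨tgt π, ⟨hnn, h3, hsum⟩, ?_, ?_⟩
  -- If `r` still lacked mass, a small redirection from a source `a` would stay in `K` and raise the
  -- mass at `r`.
  · by_contra hne1
    have hlt : tgt π r < 1 := lt_of_le_of_ne (h3 r) hne1
    have hmr : F T.root ≤ T.mass (tgt π) T.root := by
      rw [mass, T.cluster_root, hsum]; exact hroot
    obtain ⟨a, ha0, ha1, ha2⟩ := T.exists_source hsup hmr (hlt.trans_le hr)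
    have har : a ≠ r := by
      rintro rfl
      linarith
    have hapos : 0 < tgt π a := (hF _).trans_lt ha0
    obtain ⟨ε, hε, hεb, hpot⟩ := T.exists_pot_decrease ha1 ha2
      (lt_min hapos (sub_pos.2 hlt))
    obtain ⟨π', hπ', hcost⟩ := hplan.redirect (r := r) hε.le hapos (hεb.trans (min_le_left _ _))
    have ht' : tgt π' = fun x => tgt π x + ε * ((if x = r then 1 else 0) -
        if x = a then 1 else 0) := by ext y; exact hπ'.target y
    have hmem : π' ∈ K := by
      refine ⟨hπ'.nonneg, hπ'.source, fun y => ?_, ?_⟩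
      · rw [ht']
        have hε2 := hεb.trans (min_le_right _ _)
        have := h3 y
        by_cases hyr : y = r
        · subst hyr
          simp only [if_true, if_neg har.symm]
          linarith
        · simp only [if_neg hyr]
          split_ifs <;> linarith
      · rw [ht']
        have := mul_le_mul_of_nonneg_left (hdist a r) hε.le
        linarith
    have hle : tgt π' r ≤ tgt π r := hmax hmem
    rw [ht'] at hle
    simp only [if_true, if_neg har.symm] at hle
    linarith
  · exact (add_le_add (earthmover_le hplan) le_rfl).trans h4

/-- The earthmover distance bounds the change of the subtree masses. -/
lemma sum_abs_mass_sub_le [MetricSpace X] (hdist : ∀ x y, T.nodeDist x y ≤ 3 * dist x y)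
    {k : ℕ} (hk : 1 ≤ k) {z z' : X → ℝ} (hz : IsFractionalConfig k z)
    (hz' : IsFractionalConfig k z') :
    ∑ u, T.w u * |T.mass z' u - T.mass z u| ≤ 3 * earthmover z z' := by
  classical
  have hkr : (0 : ℝ) < k := by exact_mod_cast hk
  suffices h : (∑ u, T.w u * |T.mass z' u - T.mass z u|) / 3 ≤ earthmover z z' by linarith
  -- A lower bound on the infimum requires at least one plan; the scaled product of the two
  -- distributions is one.
  obtain ⟨π₀, hπ₀⟩ := exists_isTransportPlan hkr hz.nonneg hz'.nonneg hz.sum_eq hz'.sum_eq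
  refine le_csInf ⟨_, π₀, hπ₀, rfl⟩ ?_
  rintro c ⟨π, hπ, rfl⟩
  rw [div_le_iff₀ three_pos]
  have h1 : ∀ u, |T.mass z' u - T.mass z u| ≤ ∑ x, ∑ y, π x y *
      |(T.cluster u : Set X).indicator (fun _ => (1 : ℝ)) x -
        (T.cluster u : Set X).indicator (fun _ => (1 : ℝ)) y| := by
    intro u
    have e1 : T.mass z u = ∑ x, ∑ y, π x y *
        (T.cluster u : Set X).indicator (fun _ => (1 : ℝ)) x := by
      simp only [← Finset.sum_mul, hπ.source]
      simp [mass, Set.indicator_apply, Finset.sum_ite_mem]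
    have e2 : T.mass z' u = ∑ x, ∑ y, π x y *
        (T.cluster u : Set X).indicator (fun _ => (1 : ℝ)) y := by
      rw [Finset.sum_comm]
      simp only [← Finset.sum_mul, hπ.target]
      simp [mass, Set.indicator_apply, Finset.sum_ite_mem]
    rw [e1, e2, abs_sub_comm]
    simp only [← Finset.sum_sub_distrib, ← mul_sub]
    refine (Finset.abs_sum_le_sum_abs _ _).trans (Finset.sum_le_sum fun x _ => ?_)
    refine (Finset.abs_sum_le_sum_abs _ _).trans (Finset.sum_le_sum fun y _ => ?_)
    rw [abs_mul, abs_of_nonneg (hπ.nonneg x y)]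
  calc ∑ u, T.w u * |T.mass z' u - T.mass z u|
      ≤ ∑ u, T.w u * ∑ x, ∑ y, π x y *
        |(T.cluster u : Set X).indicator (fun _ => (1 : ℝ)) x -
        (T.cluster u : Set X).indicator (fun _ => (1 : ℝ)) y| :=
        Finset.sum_le_sum fun u _ => mul_le_mul_of_nonneg_left (h1 u) (T.w_pos u).le
    _ = ∑ x, ∑ y, π x y * T.nodeDist x y := by
        simp only [Finset.mul_sum, nodeDist]
        rw [Finset.sum_comm]
        refine Finset.sum_congr rfl fun x _ => ?_
        rw [Finset.sum_comm]
        refine Finset.sum_congr rfl fun y _ => Finset.sum_congr rfl fun u _ => ?_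
        ring
    _ ≤ ∑ x, ∑ y, 3 * (π x y * dist x y) :=
        Finset.sum_le_sum fun x _ => Finset.sum_le_sum fun y _ => by
          have := mul_le_mul_of_nonneg_left (hdist x y) (hπ.nonneg x y)
          linarith
    _ = (∑ x, ∑ y, π x y * dist x y) * 3 := by
        simp only [← Finset.mul_sum]; ring

end Hierarchy

/-! ### The algorithm and its potential analysis -/

lemma ServerConfig.isFractionalConfig {X : Type*} [Fintype X] {k : ℕ} (A : ServerConfig X k) :
    IsFractionalConfig k A.toVec where
  nonneg x := Set.indicator_nonneg (fun _ _ => zero_le_one) x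
  le_one x := Set.indicator_le_self' (fun _ _ => zero_le_one) x
  sum_eq := by
    classical
    rw [ServerConfig.toVec, Finset.sum_indicator_subset (fun _ : X => (1 : ℝ)) (Finset.subset_univ A.1)]
    simp [A.2]

namespace Hierarchy

variable {X N : Type*} [Fintype X] [Fintype N] [DecidableEq N] (T : Hierarchy X N)

lemma mass_toVec {k : ℕ} (A : ServerConfig X k) (u : N) : T.mass A.toVec u = T.load A.1 u :=
  (T.load_eq_sum A.1 u).symm

/-- The states of the algorithm: a feasible allotment vector and a fractional configuration. -/
abbrev State (k : ℕ) : Type _ :=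
  {s : (N × ℕ → ℝ) × (X → ℝ) //
    s.1 ∈ T.polytope k ∧ (∀ p, s.1 p ≤ 2) ∧ IsFractionalConfig k s.2}

/-- The potential of a state with respect to an integral configuration. -/
noncomputable def statePot {k : ℕ} (m : ℕ) (A : ServerConfig X k) (s : T.State k) : ℝ :=
  T.pot s.1.2 (T.capacity k s.1.1) - 2 * T.linPot s.1.1 +
    32 * m * T.div (T.optPoint k A.1) s.1.1

/-- Changing the capacities raises `pot` by at most twice the allotment movement, hence by twice the
change of `linPot` plus `32 * m * G`. The other two terms of `statePot` cancel exactly this, and the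
lazy move is paid by `pot`. -/
theorem exists_serving_state [MetricSpace X] (hdist : ∀ x y, dist x y ≤ T.nodeDist x y)
    {k : ℕ} (hk : 1 ≤ k) (hX : k ≤ Fintype.card X) {m : ℕ} (hm : ∀ u, T.depth u ≤ m)
    (s : T.State k) (r : X) :
    ∃ s' : T.State k, s'.1.2 r = 1 ∧ ∀ A : ServerConfig X k, r ∈ A.1 →
      earthmover s.1.2 s'.1.2 + T.statePot m A s' ≤ T.statePot m A s := by
  obtain ⟨⟨z, c⟩, hz, hz2, hc⟩ := s
  obtain ⟨y, hy, hy2, hyr, G, hG, hdiv, hmov⟩ := T.exists_serving_point hk hX hm z hz hz2 r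
  obtain ⟨c', hc', hcr, hmove⟩ := T.exists_lazy_move hdist hc (F := T.capacity k y)
    (T.capacity_nonneg k y) (fun u hu => T.sum_capacity_children_le hk hy hu)
    (T.capacity_root_le hk hy) (T.one_le_capacity_pt hk hyr)
  refine ⟨⟨(y, c'), hy, hy2, hc'⟩, hcr, fun A hA => ?_⟩
  have h1 := hdiv _ (T.optPoint_mem A.2) (T.optPoint_pt k hA)
  have h2 := T.pot_le_pot_add c (T.capacity k z) (T.capacity k y)
  have h3 := T.sum_abs_capacity_sub_le hk z y
  have h4 : (0 : ℝ) ≤ 32 * m := by positivity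
  have h5 := mul_le_mul_of_nonneg_left h1 h4
  simp only [statePot]
  linarith

/-- Only the divergence depends on the offline configuration. The constant is `32 * 10 * 3`: weight
in the potential, Lipschitz constant, distortion of the distances. -/
lemma statePot_le_add [MetricSpace X] (hdist : ∀ x y, T.nodeDist x y ≤ 3 * dist x y)
    {k : ℕ} (hk : 1 ≤ k) (m : ℕ) (A B : ServerConfig X k) (s : T.State k) :
    T.statePot m B s ≤ T.statePot m A s +
      960 * m * Real.log (k + 1) * earthmover A.toVec B.toVec := by
  have h1 := T.div_optPoint_sub_le hk A.1 B.1 s.2.1 s.2.2.1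
  have h2 := T.sum_abs_mass_sub_le hdist hk A.isFractionalConfig B.isFractionalConfig
  simp only [mass_toVec] at h2
  have hlog : 0 ≤ 10 * Real.log ((k : ℝ) + 1) := by
    have : 0 ≤ Real.log ((k : ℝ) + 1) := Real.log_nonneg (by linarith [Nat.cast_nonneg (α := ℝ) k])
    positivity
  have h3 := h1.trans (mul_le_mul_of_nonneg_left h2 hlog)
  have h4 : (0 : ℝ) ≤ 32 * m := by positivity
  have h5 := mul_le_mul_of_nonneg_left h3 h4
  simp only [statePot]
  linarith

lemma le_statePot {k : ℕ} (hk : 1 ≤ k) (m : ℕ) (A : ServerConfig X k) (s : T.State k) :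
    -2 * ∑ p ∈ slots (X := X) (N := N), T.slotWeight p * (4 * (T.depth p.1 : ℝ) * 2) ≤
      T.statePot m A s := by
  have h1 := T.pot_nonneg s.1.2 (T.capacity k s.1.1)
  have h2 := T.div_nonneg hk (T.optPoint_mem A.2) s.2.1
  have h3 : T.linPot s.1.1 ≤
      ∑ p ∈ slots (X := X) (N := N), T.slotWeight p * (4 * (T.depth p.1 : ℝ) * 2) := by
    refine Finset.sum_le_sum fun p _ => mul_le_mul_of_nonneg_left ?_ (T.w_pos p.1).le
    have h4 := s.2.2.1 p
    have h5 : 0 ≤ s.1.1 p := (floorVal_pos hk).le.trans (s.2.1.1 p)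
    have h6 : (0 : ℝ) ≤ 4 * T.depth p.1 := by positivity
    nlinarith
  have h4 : (0 : ℝ) ≤ 32 * m * T.div (T.optPoint k A.1) s.1.1 := by positivity
  simp only [statePot]
  linarith

/-- Every hierarchy of depth `m` admits an `O(m log k)`-competitive fractional algorithm. -/
theorem exists_isCompetitive [MetricSpace X] (hdist : ∀ x y, dist x y ≤ T.nodeDist x y)
    (hdist' : ∀ x y, T.nodeDist x y ≤ 3 * dist x y) {k : ℕ} (hk : 1 ≤ k) {m : ℕ}
    (hm : ∀ u, T.depth u ≤ m) :
    ∃ alg : FractionalAlgorithm X k, alg.IsCompetitive (960 * m * Real.log (k + 1)) := by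
  -- Without any configuration of `k` distinct points the claim is vacuous.
  rcases isEmpty_or_nonempty (ServerConfig X k) with hE | ⟨⟨A₁, hA₁⟩⟩
  · exact ⟨⟨fun A => isEmptyElim A, fun A => isEmptyElim A, fun A => isEmptyElim A,
      fun A => isEmptyElim A⟩, 0, fun A => isEmptyElim A⟩
  have hX : k ≤ Fintype.card X := hA₁ ▸ Finset.card_le_univ A₁
  choose step hserve hstep using T.exists_serving_state hdist hk hX hm
  set start : ServerConfig X k → T.State k := fun A₀ =>
    ⟨(T.optPoint k A₀.1, A₀.toVec), T.optPoint_mem A₀.2, T.optPoint_le_two hk A₀.1,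
      A₀.isFractionalConfig⟩ with hstart
  set run : ServerConfig X k → List X → T.State k := fun A₀ σ => σ.foldl step (start A₀) with hrun
  have hrun_append : ∀ A₀ σ r, run A₀ (σ ++ [r]) = step (run A₀ σ) r := fun A₀ σ r => by
    simp [hrun, List.foldl_append]
  refine ⟨⟨fun A₀ σ => (run A₀ σ).1.2, fun A₀ => rfl, fun A₀ σ => (run A₀ σ).2.2.2,
    fun A₀ σ r => ?_⟩, ?_⟩
  · simp only [hrun_append]
    exact hserve _ _
  -- There are finitely many pairs of starting configurations, so the initial potential has a bound
  -- independent of the requests.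
  obtain ⟨B, hB⟩ := (Set.finite_range fun p : ServerConfig X k × ServerConfig X k =>
    T.statePot m p.2 (start p.1)).bddAbove
  refine ⟨B + 2 * ∑ p ∈ slots (X := X) (N := N), T.slotWeight p * (4 * (T.depth p.1 : ℝ) * 2),
    fun A₀ σ A hA => ?_⟩
  have main : ∀ t ≤ σ.length,
      ∑ i ∈ range t, earthmover (run A₀ (σ.take i)).1.2 (run A₀ (σ.take (i + 1))).1.2 +
        T.statePot m (A t) (run A₀ (σ.take t)) ≤
      T.statePot m (A 0) (start A₀) + 960 * m * Real.log (k + 1) * integralCost A t := by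
    intro t
    induction t with
    | zero => intro _; simp [integralCost, hrun]
    | succ t ih =>
      intro ht
      have h1 := ih (by omega)
      have htake : σ.take (t + 1) = σ.take t ++ [σ[t]] := by
        rw [List.take_append_getElem]
      have h2 := hstep (run A₀ (σ.take t)) σ[t] (A (t + 1)) (hA t (by omega))
      rw [← hrun_append, ← htake] at h2
      have h3 := T.statePot_le_add hdist' hk m (A t) (A (t + 1)) (run A₀ (σ.take t))
      rw [Finset.sum_range_succ]
      rw [integralCost, Finset.sum_range_succ, ← integralCost, mul_add]
      linarith
  have h1 := main σ.length le_rfl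
  have h2 := T.le_statePot hk m (A σ.length) (run A₀ (σ.take σ.length))
  have h3 : T.statePot m (A 0) (start A₀) ≤ B := hB ⟨(A₀, A 0), rfl⟩
  rw [FractionalAlgorithm.cost]
  simp only
  linarith

end Hierarchy

/-! ### Rooted trees -/

section RootedTree

variable {V : Type*} {G : SimpleGraph V}

/-- The neighbour of `v` that is closer to `r` (and `v` itself if there is none). -/
noncomputable def treeParent (G : SimpleGraph V) (r v : V) : V :=
  open Classical in
  if h : ∃ u, G.Adj v u ∧ G.dist r v = G.dist r u + 1 then h.choose else v

/-- `a` lies in the subtree hanging at `u`. -/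
def IsBelow (G : SimpleGraph V) (r u a : V) : Prop := ∃ i : ℕ, (treeParent G r)^[i] a = u

lemma treeParent_root (r : V) : treeParent G r r = r := by
  rw [treeParent, dif_neg]
  rintro ⟨u, -, hu⟩
  simp at hu

lemma treeParent_spec (hG : G.IsTree) {r v : V} (hv : v ≠ r) :
    G.Adj v (treeParent G r v) ∧ G.dist r v = G.dist r (treeParent G r v) + 1 := by
  have h : ∃ u, G.Adj v u ∧ G.dist r v = G.dist r u + 1 := by
    obtain ⟨p, hp⟩ := hG.connected.exists_walk_length_eq_dist v r
    cases p with
    | nil => exact absurd rfl hv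
    | @cons _ u _ hadj q =>
      refine ⟨u, hadj, ?_⟩
      have h1 := G.dist_le q
      rw [SimpleGraph.Walk.length_cons, SimpleGraph.dist_comm] at hp
      rw [SimpleGraph.dist_comm] at h1
      rcases hG.dist_eq_dist_add_one_of_adj r hadj with h2 | h2 <;> omega
  rw [treeParent, dif_pos h]
  exact h.choose_spec

/-- Appending the edge to a shortest walk from `r` gives a path to `v` with prescribed penultimate
vertex, and paths in a tree are unique. -/
lemma eq_treeParent (hG : G.IsTree) {r v u : V} (hadj : G.Adj v u)
    (hd : G.dist r v = G.dist r u + 1) : u = treeParent G r v := by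
  have key : ∀ w, G.Adj v w → G.dist r v = G.dist r w + 1 →
      ∃ p : G.Walk r v, p.IsPath ∧ p.penultimate = w := by
    intro w hw hdw
    obtain ⟨p, hp⟩ := hG.connected.exists_walk_length_eq_dist r w
    refine ⟨p.concat hw.symm, ?_, by simp⟩
    apply SimpleGraph.Walk.isPath_of_length_eq_dist
    rw [SimpleGraph.Walk.length_concat, hp, hdw]
  have hv : v ≠ r := by rintro rfl; simp at hd
  obtain ⟨p, hp, rfl⟩ := key u hadj hd
  obtain ⟨h1, h2⟩ := treeParent_spec hG hv
  obtain ⟨q, hq, hq'⟩ := key _ h1 h2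
  rw [← hq', (hG.existsUnique_path r v).unique hp hq]

lemma dist_treeParent (hG : G.IsTree) (r v : V) :
    G.dist r (treeParent G r v) = G.dist r v - 1 := by
  by_cases hv : v = r
  · subst hv; simp [treeParent_root]
  · have := (treeParent_spec hG hv).2; omega

lemma dist_iterate_treeParent (hG : G.IsTree) (r v : V) (i : ℕ) :
    G.dist r ((treeParent G r)^[i] v) = G.dist r v - i := by
  induction i with
  | zero => simp
  | succ i ih => rw [Function.iterate_succ_apply', dist_treeParent hG, ih]; omega

lemma iterate_treeParent_dist (hG : G.IsTree) (r v : V) :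
    (treeParent G r)^[G.dist r v] v = r := by
  have h := dist_iterate_treeParent hG r v (G.dist r v)
  rw [Nat.sub_self] at h
  exact (hG.connected.dist_eq_zero_iff.1 h).symm

/-- Each step towards the root lowers the level by one and the root is fixed, so the number of steps
can be read off the levels. -/
lemma isBelow_iff (hG : G.IsTree) {r u a : V} :
    IsBelow G r u a ↔ G.dist r u ≤ G.dist r a ∧
      (treeParent G r)^[G.dist r a - G.dist r u] a = u := by
  refine ⟨?_, fun h => ⟨_, h.2⟩⟩
  rintro ⟨i, rfl⟩
  rw [dist_iterate_treeParent hG]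
  refine ⟨Nat.sub_le _ _, ?_⟩
  rcases le_total i (G.dist r a) with h | h
  · rw [Nat.sub_sub_self h]
  · obtain ⟨j, rfl⟩ := Nat.exists_eq_add_of_le h
    rw [Nat.sub_eq_zero_of_le h, Nat.sub_zero, Nat.add_comm, Function.iterate_add_apply,
      iterate_treeParent_dist hG, Function.iterate_fixed (treeParent_root r)]

lemma isBelow_refl (r u : V) : IsBelow G r u u := ⟨0, rfl⟩

lemma isBelow_root (hG : G.IsTree) (r a : V) : IsBelow G r r a :=
  ⟨_, iterate_treeParent_dist hG r a⟩

lemma IsBelow.trans {r u v a : V} (h : IsBelow G r u v) (h' : IsBelow G r v a) :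
    IsBelow G r u a := by
  obtain ⟨i, rfl⟩ := h
  obtain ⟨j, rfl⟩ := h'
  exact ⟨i + j, Function.iterate_add_apply _ _ _ _⟩

lemma isBelow_treeParent_iff {r u a : V} :
    IsBelow G r u a ↔ a = u ∨ IsBelow G r u (treeParent G r a) := by
  constructor
  · rintro ⟨_ | i, hi⟩
    · exact Or.inl hi
    · exact Or.inr ⟨i, hi⟩
  · rintro (rfl | ⟨i, hi⟩)
    · exact isBelow_refl _ _
    · exact ⟨i + 1, hi⟩

lemma IsBelow.of_dist_le (hG : G.IsTree) {r u v a : V} (hu : IsBelow G r u a)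
    (hv : IsBelow G r v a) (h : G.dist r u ≤ G.dist r v) : IsBelow G r u v := by
  obtain ⟨hu, hu'⟩ := (isBelow_iff hG).1 hu
  obtain ⟨hv, hv'⟩ := (isBelow_iff hG).1 hv
  refine ⟨G.dist r v - G.dist r u, ?_⟩
  conv_lhs => rw [← hv']
  rw [← Function.iterate_add_apply]
  convert hu' using 2
  rw [hv']
  omega

lemma IsBelow.eq_of_dist_eq (hG : G.IsTree) {r u v a : V} (hu : IsBelow G r u a)
    (hv : IsBelow G r v a) (h : G.dist r u = G.dist r v) : u = v := by
  have := ((isBelow_iff hG).1 (hu.of_dist_le hG hv h.le)).2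
  rwa [h, Nat.sub_self, Function.iterate_zero_apply, eq_comm] at this

/-- The edge above `u`. -/
noncomputable def parentEdge (G : SimpleGraph V) (r u : V) : Sym2 V := s(u, treeParent G r u)

lemma parentEdge_injOn (hG : G.IsTree) {r u v : V} (hu : u ≠ r) (hv : v ≠ r)
    (h : parentEdge G r u = parentEdge G r v) : u = v := by
  have h1 := (treeParent_spec hG hu).2
  have h2 := (treeParent_spec hG hv).2
  rcases Sym2.eq_iff.1 h with ⟨h, -⟩ | ⟨h3, h4⟩
  · exact h
  · rw [h4] at h1; rw [← h3] at h2; omega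

lemma exists_parentEdge_eq (hG : G.IsTree) (r : V) {a b : V} (hadj : G.Adj a b) :
    ∃ u, u ≠ r ∧ s(a, b) = parentEdge G r u ∧ ((a = u ∧ b = treeParent G r u) ∨
      (b = u ∧ a = treeParent G r u)) := by
  rcases hG.dist_eq_dist_add_one_of_adj r hadj with h | h
  · refine ⟨a, by rintro rfl; simp at h, ?_, Or.inl ⟨rfl, eq_treeParent hG hadj h⟩⟩
    rw [parentEdge, ← eq_treeParent hG hadj h]
  · refine ⟨b, by rintro rfl; simp at h, ?_, Or.inr ⟨rfl, eq_treeParent hG hadj.symm h⟩⟩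
    rw [parentEdge, ← eq_treeParent hG hadj.symm h, Sym2.eq_swap]

lemma isBelow_parent_iff (hG : G.IsTree) {r u v : V} (hu : u ≠ r) (hv : v ≠ r) :
    (IsBelow G r u v ↔ IsBelow G r u (treeParent G r v)) ↔ parentEdge G r u ≠ parentEdge G r v := by
  by_cases h : u = v
  · subst h
    have h1 := (treeParent_spec hG hu).2
    have h2 : ¬ IsBelow G r u (treeParent G r u) := fun h =>
      absurd ((isBelow_iff hG).1 h).1 (by omega)
    simp [isBelow_refl, h2]
  · have h1 : parentEdge G r u ≠ parentEdge G r v := fun h' => h (parentEdge_injOn hG hu hv h')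
    rw [isBelow_treeParent_iff]
    simp [h1, Ne.symm h]

lemma isBelow_adj_iff (hG : G.IsTree) {r u a b : V} (hu : u ≠ r) (hadj : G.Adj a b) :
    (IsBelow G r u a ↔ IsBelow G r u b) ↔ s(a, b) ≠ parentEdge G r u := by
  obtain ⟨v, hv, he, ⟨rfl, rfl⟩ | ⟨rfl, rfl⟩⟩ := exists_parentEdge_eq hG r hadj
  · rw [isBelow_parent_iff hG hu hv, he, ne_comm]
  · rw [iff_comm (a := IsBelow G r u _), isBelow_parent_iff hG hu hv, he, ne_comm]

/-- A walk enters or leaves the subtree at `u` exactly when it uses the edge above `u`. -/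
lemma isBelow_iff_even_count [DecidableEq V] (hG : G.IsTree) {r u : V} (hu : u ≠ r) {a b : V}
    (p : G.Walk a b) :
    (IsBelow G r u a ↔ IsBelow G r u b) ↔ Even (p.edges.count (parentEdge G r u)) := by
  induction p with
  | nil => simp
  | @cons a c b hadj q ih =>
    have h := isBelow_adj_iff hG hu hadj
    rw [SimpleGraph.Walk.edges_cons, List.count_cons]
    by_cases he : s(a, c) = parentEdge G r u
    · simp only [he, ne_eq, not_true_eq_false, iff_false] at h
      simp only [he, beq_self_eq_true, if_true, Nat.even_add_one]
      tauto
    · simp only [ne_eq, he, not_false_eq_true, iff_true] at h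
      simp only [beq_iff_eq, he, if_false, add_zero]
      rw [h, ih]

lemma walkLength_eq_sum [Fintype V] [DecidableEq V] (hG : G.IsTree) (ℓ : Sym2 V → ℝ) (r : V)
    {a b : V} (p : G.Walk a b) :
    walkLength ℓ p =
      ∑ u ∈ univ.erase r, ℓ (parentEdge G r u) * p.edges.count (parentEdge G r u) := by
  induction p with
  | nil => simp [walkLength]
  | @cons a c b hadj q ih =>
    obtain ⟨v, hv, he, -⟩ := exists_parentEdge_eq hG r hadj
    have h1 : ∑ u ∈ univ.erase r, ℓ (parentEdge G r u) *
        (if s(a, c) = parentEdge G r u then (1 : ℝ) else 0) = ℓ s(a, c) := by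
      rw [Finset.sum_eq_single v]
      · rw [if_pos he, he, mul_one]
      · intro u hu huv
        rw [if_neg, mul_zero]
        intro h
        exact huv (parentEdge_injOn hG (Finset.ne_of_mem_erase hu) hv (h.symm.trans he))
      · simp [hv]
    have h2 : walkLength ℓ (SimpleGraph.Walk.cons hadj q) = ℓ s(a, c) + walkLength ℓ q := by
      simp [walkLength]
    rw [h2, ih, ← h1, ← Finset.sum_add_distrib]
    refine Finset.sum_congr rfl fun u _ => ?_
    rw [SimpleGraph.Walk.edges_cons, List.count_cons]
    simp only [beq_iff_eq]
    push_cast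
    ring

open Classical in
lemma walkLength_eq_sum_abs [Fintype V] [DecidableEq V] (hG : G.IsTree) (ℓ : Sym2 V → ℝ) (r : V)
    {a b : V} (p : G.Walk a b) (hp : p.IsPath) :
    walkLength ℓ p = ∑ u ∈ univ.erase r, ℓ (parentEdge G r u) *
      |(if IsBelow G r u a then (1 : ℝ) else 0) - if IsBelow G r u b then (1 : ℝ) else 0| := by
  rw [walkLength_eq_sum hG ℓ r]
  refine Finset.sum_congr rfl fun u hu => ?_
  congr 1
  have h1 := isBelow_iff_even_count hG (Finset.ne_of_mem_erase hu) p
  have h2 : p.edges.count (parentEdge G r u) ≤ 1 := hp.isTrail.count_edges_le_one _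
  interval_cases p.edges.count (parentEdge G r u)
  · simp only [Even.zero, iff_true] at h1
    simp [h1]
  · by_cases ha : IsBelow G r u a <;> by_cases hb : IsBelow G r u b <;> simp_all

lemma length_le_hopDiameter [Fintype V] {a b : V} {p : G.Walk a b} (hp : p.IsPath) :
    p.length ≤ hopDiameter G := by
  refine le_csSup ⟨Fintype.card V, ?_⟩ ⟨a, b, p, hp, rfl⟩
  rintro _ ⟨a, b, p, hp, rfl⟩
  exact hp.length_lt.le

lemma dist_le_hopDiameter [Fintype V] (hG : G.IsTree) (a b : V) : G.dist a b ≤ hopDiameter G := by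
  obtain ⟨p, hp, hp'⟩ := hG.connected.exists_path_of_dist a b
  exact hp' ▸ length_le_hopDiameter hp

end RootedTree

/-! ### The hierarchy of a tree metric -/

section TreeHierarchy

variable {X V : Type*} [Fintype X] {G : SimpleGraph V}

open Classical in
/-- The points below a vertex, or below a pendant node. -/
noncomputable def treeCluster (G : SimpleGraph V) (φ : X → V) (r : V) : V ⊕ X → Finset X
  | Sum.inl u => univ.filter fun x => IsBelow G r u (φ x)
  | Sum.inr x => {x}

/-- The number of edges above a vertex, or above a pendant node. -/
noncomputable def treeDepth (G : SimpleGraph V) (φ : X → V) (r : V) : V ⊕ X → ℕ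
  | Sum.inl u => G.dist r u
  | Sum.inr x => G.dist r (φ x) + 1

/-- The node above a vertex, or above a pendant node. -/
noncomputable def treePar (G : SimpleGraph V) (φ : X → V) (r : V) : V ⊕ X → V ⊕ X
  | Sum.inl u => Sum.inl (treeParent G r u)
  | Sum.inr x => Sum.inl (φ x)

open Classical in
/-- The length of the edge above a vertex, or above a pendant node. -/
noncomputable def treeWeight (G : SimpleGraph V) (ℓ : Sym2 V → ℝ) (r : V) (ε : ℝ) : V ⊕ X → ℝ
  -- The root has no edge above it. Its positive dummy weight does not affect `nodeDist`, since all
  -- points lie below the root.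
  | Sum.inl u => if u = r then 1 else ℓ (parentEdge G r u)
  | Sum.inr _ => ε

lemma mem_treeCluster_inl {φ : X → V} {r u : V} {x : X} :
    x ∈ treeCluster G φ r (Sum.inl u) ↔ IsBelow G r u (φ x) := by
  simp [treeCluster]

lemma mem_treeCluster_inr {φ : X → V} {r : V} {x y : X} :
    x ∈ treeCluster G φ r (Sum.inr y) ↔ x = y := by
  simp [treeCluster]

lemma treeCluster_subset (hG : G.IsTree) (φ : X → V) (r : V) (a : X) (u v : V ⊕ X)
    (hu : a ∈ treeCluster G φ r u) (hv : a ∈ treeCluster G φ r v)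
    (h : treeDepth G φ r u ≤ treeDepth G φ r v) : treeCluster G φ r v ⊆ treeCluster G φ r u := by
  intro b hb
  rcases v with v | y
  · rw [mem_treeCluster_inl] at hv hb
    rcases u with u | x
    · rw [mem_treeCluster_inl] at hu ⊢
      exact (hu.of_dist_le hG hv h).trans hb
    · obtain rfl := mem_treeCluster_inr.1 hu
      have := ((isBelow_iff hG).1 hv).1
      simp only [treeDepth] at h
      omega
  · obtain rfl := mem_treeCluster_inr.1 hv
    obtain rfl := mem_treeCluster_inr.1 hb
    exact hu

lemma eq_of_mem_treeCluster (hG : G.IsTree) (φ : X → V) (r : V) (a : X) (u v : V ⊕ X)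
    (hu : a ∈ treeCluster G φ r u) (hv : a ∈ treeCluster G φ r v)
    (h : treeDepth G φ r u = treeDepth G φ r v) : u = v := by
  rcases u with u | x <;> rcases v with v | y
  · rw [mem_treeCluster_inl] at hu hv
    rw [hu.eq_of_dist_eq hG hv h]
  · obtain rfl := mem_treeCluster_inr.1 hv
    have := ((isBelow_iff hG).1 (mem_treeCluster_inl.1 hu)).1
    simp only [treeDepth] at h
    omega
  · obtain rfl := mem_treeCluster_inr.1 hu
    have := ((isBelow_iff hG).1 (mem_treeCluster_inl.1 hv)).1
    simp only [treeDepth] at h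
    omega
  · rw [← mem_treeCluster_inr.1 hu, ← mem_treeCluster_inr.1 hv]

lemma treeDepth_treePar {X : Type*} (hG : G.IsTree) (φ : X → V) (r : V) (u : V ⊕ X) (hu : u ≠ Sum.inl r) :
    treeDepth G φ r u = treeDepth G φ r (treePar G φ r u) + 1 := by
  rcases u with u | x
  · exact (treeParent_spec hG fun h => hu (congrArg Sum.inl h)).2
  · rfl

lemma treeCluster_subset_par (φ : X → V) (r : V) (v : V ⊕ X) :
    treeCluster G φ r v ⊆ treeCluster G φ r (treePar G φ r v) := by
  intro x hx
  rcases v with v | y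
  · exact mem_treeCluster_inl.2 (IsBelow.trans ⟨1, rfl⟩ (mem_treeCluster_inl.1 hx))
  · obtain rfl := mem_treeCluster_inr.1 hx
    exact mem_treeCluster_inl.2 (isBelow_refl _ _)

lemma exists_child_of_mem_treeCluster (hG : G.IsTree) (φ : X → V) (r u : V) (x : X)
    (hx : x ∈ treeCluster G φ r (Sum.inl u)) :
    ∃ v, v ≠ Sum.inl r ∧ treePar G φ r v = Sum.inl u ∧ x ∈ treeCluster G φ r v := by
  obtain ⟨h1, h2⟩ := (isBelow_iff hG).1 (mem_treeCluster_inl.1 hx)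
  rcases h1.eq_or_lt with h | h
  · rw [h, Nat.sub_self, Function.iterate_zero_apply] at h2
    exact ⟨Sum.inr x, by simp, by simp [treePar, h2], mem_treeCluster_inr.2 rfl⟩
  · obtain ⟨i, hi⟩ : ∃ i, G.dist r (φ x) - G.dist r u = i + 1 :=
      ⟨G.dist r (φ x) - G.dist r u - 1, by omega⟩
    rw [hi, Function.iterate_succ_apply'] at h2
    refine ⟨Sum.inl ((treeParent G r)^[i] (φ x)), fun h3 => ?_, by rw [treePar, h2],
      mem_treeCluster_inl.2 ⟨i, rfl⟩⟩
    have h4 := dist_iterate_treeParent hG r (φ x) i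
    rw [Sum.inl.inj h3, SimpleGraph.dist_self] at h4
    omega

lemma sum_treeCluster_children [Fintype V] [DecidableEq V] [DecidableEq X] (hG : G.IsTree) (φ : X → V) (r u : V) (f : X → ℝ) :
    ∑ x ∈ treeCluster G φ r (Sum.inl u), f x =
      ∑ v ∈ univ.filter (fun v => v ≠ Sum.inl r ∧ treePar G φ r v = Sum.inl u),
        ∑ x ∈ treeCluster G φ r v, f x := by
  rw [← Finset.sum_biUnion]
  · refine Finset.sum_congr (Finset.ext fun x => ?_) fun _ _ => rfl
    simp only [Finset.mem_biUnion, Finset.mem_filter, Finset.mem_univ, true_and]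
    constructor
    · intro hx
      obtain ⟨v, h1, h2, h3⟩ := exists_child_of_mem_treeCluster hG φ r u x hx
      exact ⟨v, ⟨h1, h2⟩, h3⟩
    · rintro ⟨v, ⟨-, h2⟩, h3⟩
      exact h2 ▸ treeCluster_subset_par φ r v h3
  · intro v hv v' hv' hne
    simp only [Finset.coe_filter, Finset.mem_univ, true_and, Set.mem_ofPred_eq] at hv hv'
    refine Finset.disjoint_left.2 fun a ha ha' => hne ?_
    refine eq_of_mem_treeCluster hG φ r a v v' ha ha' ?_
    rw [treeDepth_treePar hG φ r v hv.1, treeDepth_treePar hG φ r v' hv'.1, hv.2, hv'.2]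

/-- The hierarchy of a tree rooted at `r`, with a pendant edge of length `ε` at every point. -/
noncomputable def treeHierarchy [Fintype V] [DecidableEq V] [DecidableEq X] (hG : G.IsTree) {ℓ : Sym2 V → ℝ} (hℓ : ∀ e ∈ G.edgeSet, 0 < ℓ e)
    (φ : X → V) (r : V) {ε : ℝ} (hε : 0 < ε) : Hierarchy X (V ⊕ X) where
  root := Sum.inl r
  par := treePar G φ r
  depth := treeDepth G φ r
  pt := Sum.inr
  cluster := treeCluster G φ r
  w := treeWeight G ℓ r ε
  w_pos u := by
    rcases u with u | x
    · simp only [treeWeight]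
      split_ifs with h
      · exact one_pos
      · exact hℓ _ (treeParent_spec hG h).1
    · exact hε
  depth_root := SimpleGraph.dist_self
  depth_par := treeDepth_treePar hG φ r
  cluster_root := Finset.eq_univ_of_forall fun x => mem_treeCluster_inl.2 (isBelow_root hG r _)
  cluster_pt _ := rfl
  pt_ne_root x := by simp
  par_ne_pt u _ x := by rcases u with u | y <;> simp [treePar]
  sum_children u hu f := by
    rcases u with u | x
    · exact sum_treeCluster_children hG φ r u f
    · exact absurd rfl (hu x)
  cluster_subset := treeCluster_subset hG φ r
  eq_of_mem_cluster := eq_of_mem_treeCluster hG φ r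

lemma nodeDist_treeHierarchy [Fintype V] [DecidableEq V] [DecidableEq X] [MetricSpace X]
    {ℓ : Sym2 V → ℝ} {φ : X → V}
    (h : IsTreeMetric X G ℓ φ) (r : V) {ε : ℝ} (hε : 0 < ε) {x y : X} (hxy : x ≠ y) :
    (treeHierarchy h.isTree h.length_pos φ r hε).nodeDist x y = dist x y + 2 * ε := by
  obtain ⟨p, hp, -⟩ := h.isTree.existsUnique_path (φ x) (φ y)
  rw [h.dist_eq x y p hp, walkLength_eq_sum_abs h.isTree ℓ r p hp, Hierarchy.nodeDist,
    Fintype.sum_sum_type]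
  congr 1
  · rw [← Finset.sum_erase univ (a := r)]
    · refine Finset.sum_congr rfl fun u hu => ?_
      simp only [treeHierarchy, treeWeight, Finset.ne_of_mem_erase hu, if_false,
        Set.indicator_apply, Finset.mem_coe]
      congr 4 <;> exact propext mem_treeCluster_inl
    · simp [treeHierarchy, mem_treeCluster_inl, isBelow_root h.isTree]
  · rw [Fintype.sum_eq_add x y hxy]
    · simp [treeHierarchy, treeWeight, treeCluster, hxy, hxy.symm]
      ring
    · rintro z ⟨hx, hy⟩
      simp [treeHierarchy, treeCluster, hx.symm, hy.symm]

lemma exists_le_dist (X : Type*) [Fintype X] [MetricSpace X] :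
    ∃ ε : ℝ, 0 < ε ∧ ∀ x y : X, x ≠ y → ε ≤ dist x y := by
  classical
  rcases (univ.filter fun p : X × X => p.1 ≠ p.2).eq_empty_or_nonempty with h | h
  · refine ⟨1, one_pos, fun x y hxy => absurd hxy ?_⟩
    exact Finset.filter_eq_empty_iff.1 h (mem_univ (x, y))
  · obtain ⟨p, hp, hmin⟩ := Finset.exists_min_image _ (fun p : X × X => dist p.1 p.2) h
    exact ⟨dist p.1 p.2, dist_pos.2 (Finset.mem_filter.1 hp).2, fun x y hxy =>
      hmin (x, y) (Finset.mem_filter.2 ⟨mem_univ _, hxy⟩)⟩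

theorem IsTreeMetric.exists_isCompetitive [Fintype V] [MetricSpace X] {ℓ : Sym2 V → ℝ}
    {φ : X → V}
    (h : IsTreeMetric X G ℓ φ) {k : ℕ} (hk : 1 ≤ k) :
    ∃ alg : FractionalAlgorithm X k,
      alg.IsCompetitive (960 * (hopDiameter G + 1 : ℕ) * Real.log (k + 1)) := by
  classical
  obtain ⟨r⟩ := h.isTree.connected.nonempty
  -- With pendant edges no longer than the smallest distance, `dist + 2 * ε` lies between `dist` and
  -- `3 * dist`.
  obtain ⟨ε, hε, hle⟩ := exists_le_dist X
  refine (treeHierarchy h.isTree h.length_pos φ r hε).exists_isCompetitive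
    (fun x y => ?_) (fun x y => ?_) hk fun u => ?_
  · rcases eq_or_ne x y with rfl | hxy
    · simp [Hierarchy.nodeDist]
    · rw [nodeDist_treeHierarchy h r hε hxy]; linarith
  · rcases eq_or_ne x y with rfl | hxy
    · simp [Hierarchy.nodeDist]
    · rw [nodeDist_treeHierarchy h r hε hxy]; linarith [hle x y hxy]
  · rcases u with u | x
    · exact (dist_le_hopDiameter h.isTree r u).trans (Nat.le_succ _)
    · exact Nat.succ_le_succ (dist_le_hopDiameter h.isTree r (φ x))

end TreeHierarchy

/-! ### Competitive ratios -/

section CompetitiveRatio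

variable {X : Type*} [Fintype X] [MetricSpace X] {k : ℕ}

lemma earthmover_nonneg (z z' : X → ℝ) : 0 ≤ earthmover z z' := by
  refine Real.sInf_nonneg ?_
  rintro _ ⟨π, hπ, rfl⟩
  exact Finset.sum_nonneg fun x _ => Finset.sum_nonneg fun y _ =>
    mul_nonneg (hπ.nonneg x y) dist_nonneg

lemma integralCost_nonneg (A : ℕ → ServerConfig X k) (m : ℕ) : 0 ≤ integralCost A m :=
  Finset.sum_nonneg fun _ _ => earthmover_nonneg _ _

lemma FractionalAlgorithm.IsCompetitive.mono {alg : FractionalAlgorithm X k} {c c' : ℝ}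
    (h : alg.IsCompetitive c) (hc : c ≤ c') : alg.IsCompetitive c' := by
  obtain ⟨B, hB⟩ := h
  refine ⟨B, fun A₀ σ A hA => (hB A₀ σ A hA).trans ?_⟩
  have := mul_le_mul_of_nonneg_right hc (integralCost_nonneg A σ.length)
  linarith

lemma FractionalAlgorithm.isCompetitive_of_subsingleton [Subsingleton X]
    (alg : FractionalAlgorithm X k) : alg.IsCompetitive 0 := by
  refine ⟨0, fun A₀ σ A _ => ?_⟩
  rw [zero_mul, zero_add]
  refine Finset.sum_nonpos fun t _ => ?_
  have h1 := alg.config A₀ (σ.take t)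
  have h2 := alg.config A₀ (σ.take (t + 1))
  have h3 : alg.state A₀ (σ.take t) = alg.state A₀ (σ.take (t + 1)) := by
    funext x
    have e1 := h1.sum_eq
    have e2 := h2.sum_eq
    rw [Fintype.sum_subsingleton _ x] at e1 e2
    rw [e1, e2]
  rw [← h3]
  refine csInf_le ⟨0, ?_⟩ ⟨fun x y => alg.state A₀ (σ.take t) x, ⟨fun x _ => h1.nonneg x,
    fun x => by rw [Fintype.sum_subsingleton _ x], fun y => by rw [Fintype.sum_subsingleton _ y]⟩, ?_⟩
  · rintro _ ⟨π, hπ, rfl⟩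
    exact Finset.sum_nonneg fun x _ => Finset.sum_nonneg fun y _ =>
      mul_nonneg (hπ.nonneg x y) dist_nonneg
  · symm
    refine Finset.sum_eq_zero fun x _ => Finset.sum_eq_zero fun y _ => ?_
    rw [Subsingleton.elim x y, dist_self, mul_zero]

end CompetitiveRatio

lemma IsTreeMetric.subsingleton {X V : Type*} [MetricSpace X] [Fintype V] {G : SimpleGraph V}
    {ℓ : Sym2 V → ℝ} {φ : X → V} (h : IsTreeMetric X G ℓ φ) (hD : hopDiameter G = 0) : Subsingleton X := by
  refine ⟨fun x y => dist_eq_zero.1 ?_⟩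
  obtain ⟨p, hp, -⟩ := h.isTree.existsUnique_path (φ x) (φ y)
  have h1 : p.edges = [] := by
    rw [← List.length_eq_zero_iff, SimpleGraph.Walk.length_edges]
    exact Nat.le_zero.1 (hD ▸ length_le_hopDiameter hp)
  rw [h.dist_eq x y p hp, walkLength, h1, List.map_nil, List.sum_nil]

end KServer


theorem mainTheorem4 :
    ∃ C : ℝ, 0 < C ∧
      ∀ (X : Type*) [Fintype X] [MetricSpace X] (V : Type*) [Fintype V]
        (G : SimpleGraph V) (ℓ : Sym2 V → ℝ) (φ : X → V),
        KServer.IsTreeMetric X G ℓ φ →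
        ∀ k : ℕ, 1 ≤ k →
          ∃ alg : KServer.FractionalAlgorithm X k,
            alg.IsCompetitive (C * (KServer.hopDiameter G : ℝ) * Real.log ((k : ℝ) + 1)) := by
  refine ⟨1920, by norm_num, fun X _ _ V _ G ℓ φ h k hk => ?_⟩
  obtain ⟨alg, halg⟩ := h.exists_isCompetitive hk
  refine ⟨alg, ?_⟩
  -- The pendant edges give depth `D + 1`, which is at most `2 * D` only for `D ≥ 1`; for `D = 0`
  -- there is at most one point and no movement.
  rcases Nat.eq_zero_or_pos (KServer.hopDiameter G) with hD | hD
  · have := h.subsingleton hD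
    simpa [hD] using alg.isCompetitive_of_subsingleton
  · refine halg.mono (mul_le_mul_of_nonneg_right ?_ (Real.log_nonneg (by simp)))
    have : (1 : ℝ) ≤ KServer.hopDiameter G := by exact_mod_cast hD
    push_cast
    linarith
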